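/- Let $\Sigma$ be a finite nonempty alphabet and let $\mathsf{Vars}$ be an infinite set of variables. *Spanners.* A span of a string $\mathbf{s}$ of length $n$ is $[i,j\rangle$ with $1\le i\le j\le n+1$; it selects the substring $\mathbf{s}_{[i,j\rangle}=\sigma_i\cdots\sigma_{j-1}$. A spanner $P$ has a finite variable set $\mathsf{Vars}(P)\subset\mathsf{Vars}$ and maps each $\mathbf{s}\in\Sigma^*$ to a set $P(\mathbf{s})$ of functions from $\mathsf{Vars}(P)$ to spans of $\mathbf{s}$. It is Boolean if $\mathsf{Vars}(P)=\emptyset$; it then recognizes the language of all $\mathbf{s}$ for which $P(\mathbf{s})$ is the singleton consisting of the empty function. *Regex formulas.* A regex formula is a regular expression over $\Sigma$ with capture variables, $\gamma::=\emptyset\mid\epsilon\mid\sigma\mid\gamma\vee\gamma\mid\gamma\cdot\gamma\mid\gamma^*\mid x\{\gamma\}$, that is functional: every parse of every string assigns exactly one span to each variable that occurs in $\gamma$. It defines the spanner on those variables whose records on $\mathbf{s}$ are the assignments given by the parses of the whole of $\mathbf{s}$. *Generalized core spanners.* These are the spanners obtained from those of regex formulas by finitely many applications of union and difference (of spanners with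 the same variables), projection to a subset of the variables, natural join, and string-equality selection $\zeta^=_{x,y}$ (which keeps the records $r$ with $\mathbf{s}_{r(x)}=\mathbf{s}_{r(y)}$). *RGXlog.* An RGXlog program consists of a finite set of relation symbols with arities; a finite set of rules $\varphi\leftarrow\psi_1,\dots,\psi_m$, where $\varphi$ is an atom $R(y_1,\dots,y_l)$ over these symbols, each $\psi_i$ is such an atom or a regex formula, and every variable of $\varphi$ occurs in the body; a designated output symbol $\mathrm{Out}$; and distinct variables $x_1,\dots,x_k$, where $k$ is the arity of $\mathrm{Out}$. On a string $\mathbf{s}$ it computes the least database of relations over spans that satisfies all rules, where a regex formula is read as its relation on $\mathbf{s}$. It defines the spanner with variables $x_1,\dots,x_k$ whose records on $\mathbf{s}$ are the tuples of $\mathrm{Out}$. **Theorem.** 1. No Boolean generalized core spanner recognizes the language $\{\mathbf{s}\in\Sigma^* : |\mathbf{s}|=2^n\text{ for some } n\ge 0\}$. 2. Some RGXlog program defines a Boolean spanner that recognizes this language. 3. RGXlog is strictly more expressive than generalized core spanners: every generalized core spanner is definable by an RGXlog program, and some spanner definable by an RGXlog program is not a generalized core spanner. -/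

import Mathlib

universe u v

namespace DocSpanner

/-! ### Strings and spans. Strings over the alphabet `A` are lists over `A`. -/

/-- A span `[i, j⟩` with `1 ≤ i ≤ j`. -/
@[ext]
structure Span where
  left : ℕ
  right : ℕ
  one_le_left : 1 ≤ left
  left_le_right : left ≤ right

/-- `p` is a span of the string `s`. -/
def Span.IsSpanOf {A : Type u} (p : Span) (s : List A) : Prop :=
  p.right ≤ s.length + 1

/-- The substring `s_{[i, j⟩} = σ_i ⋯ σ_{j-1}` (positions are counted from `1`). -/
def Span.substring {A : Type u} (s : List A) (p : Span) : List A :=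
  (s.drop (p.left - 1)).take (p.right - p.left)

/-- Records: functions from a set of variables to spans, written as functions to `Option Span`;
the domain of `r` is the set of all `x` with `r x ≠ none`. -/
abbrev Record (V : Type v) := V → Option Span

/-- `r` is a `(Y, s)`-record: its domain is `Y` and its values are spans of `s`. -/
def IsRecord {A : Type u} {V : Type v} (Y : Finset V) (s : List A) (r : Record V) : Prop :=
  (∀ x, (r x).isSome ↔ x ∈ Y) ∧ ∀ x p, r x = some p → p.IsSpanOf s

/-- The restriction of a record to the variables in `Y`. -/
def Record.restrict {V : Type v} [DecidableEq V] (r : Record V) (Y : Finset V) : Record V :=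
  fun x => if x ∈ Y then r x else none

/-- A document spanner over the alphabet `A` with variables from `V`. -/
@[ext]
structure Spanner (A : Type u) (V : Type v) where
  vars : Finset V
  rel : List A → Set (Record V)
  isRecord : ∀ s, ∀ r ∈ rel s, IsRecord vars s r

namespace Spanner

variable {A : Type u} {V : Type v}

/-- A spanner is Boolean if it has no variables. -/
def IsBoolean (P : Spanner A V) : Prop := P.vars = ∅

/-- A Boolean spanner is true on `s` if `P(s)` is the singleton of the empty function. -/
def IsTrueOn (P : Spanner A V) (s : List A) : Prop := P.rel s = {fun _ => none}

/-- `P` is a Boolean spanner that recognizes the language `L`. -/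
def Recognizes (P : Spanner A V) (L : Language A) : Prop :=
  P.IsBoolean ∧ ∀ s, s ∈ L ↔ P.IsTrueOn s

/-! ### Spanner algebra -/

/-- Union of union compatible spanners. -/
def union (P₁ P₂ : Spanner A V) (h : P₁.vars = P₂.vars) : Spanner A V where
  vars := P₁.vars
  rel s := P₁.rel s ∪ P₂.rel s
  isRecord := by
    rintro s r (hr | hr)
    · exact P₁.isRecord s r hr
    · exact h ▸ P₂.isRecord s r hr

/-- Difference of union compatible spanners. -/
def diff (P₁ P₂ : Spanner A V) (_h : P₁.vars = P₂.vars) : Spanner A V where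
  vars := P₁.vars
  rel s := P₁.rel s \ P₂.rel s
  isRecord := fun s r hr => P₁.isRecord s r hr.1

/-- Projection to a subset `Y` of the variables. -/
def proj [DecidableEq V] (P : Spanner A V) (Y : Finset V) (hY : Y ⊆ P.vars) : Spanner A V where
  vars := Y
  rel s := {r | ∃ r' ∈ P.rel s, r = Record.restrict r' Y}
  isRecord := by
    rintro s r ⟨r', hr', rfl⟩
    have h := P.isRecord s r' hr'
    refine ⟨fun x => ?_, fun x p hx => ?_⟩
    · by_cases hx : x ∈ Y
      · simp [Record.restrict, hx, h.1 x, hY hx]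
      · simp [Record.restrict, hx]
    · by_cases hxY : x ∈ Y
      · exact h.2 x p (by simpa [Record.restrict, hxY] using hx)
      · simp [Record.restrict, hxY] at hx

/-- Natural join. -/
def join [DecidableEq V] (P₁ P₂ : Spanner A V) : Spanner A V where
  vars := P₁.vars ∪ P₂.vars
  rel s := {r | IsRecord (P₁.vars ∪ P₂.vars) s r ∧
    Record.restrict r P₁.vars ∈ P₁.rel s ∧ Record.restrict r P₂.vars ∈ P₂.rel s}
  isRecord := fun _ _ hr => hr.1

/-- String-equality selection `ζ⁼_{x,y}` for variables `x`, `y` of `P`. -/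
def selectEq (P : Spanner A V) (x y : V) (_hx : x ∈ P.vars) (_hy : y ∈ P.vars) :
    Spanner A V where
  vars := P.vars
  rel s := {r | r ∈ P.rel s ∧ ∃ p q, r x = some p ∧ r y = some q ∧
    p.substring s = q.substring s}
  isRecord := fun s r hr => P.isRecord s r hr.1

end Spanner

/-! ### Regex formulas -/

/-- Regular expressions with capture variables. -/
inductive Regex (A : Type u) (V : Type v) : Type (max u v)
  | empty : Regex A V
  | epsilon : Regex A V
  | letter (σ : A) : Regex A V
  | alt (γ₁ γ₂ : Regex A V) : Regex A V
  | concat (γ₁ γ₂ : Regex A V) : Regex A V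
  | star (γ : Regex A V) : Regex A V
  | capture (x : V) (γ : Regex A V) : Regex A V

/-- The variables that occur in a regular expression with capture variables. -/
def Regex.vars {A : Type u} {V : Type v} [DecidableEq V] : Regex A V → Finset V
  | .empty => ∅
  | .epsilon => ∅
  | .letter _ => ∅
  | .alt γ₁ γ₂ => γ₁.vars ∪ γ₂.vars
  | .concat γ₁ γ₂ => γ₁.vars ∪ γ₂.vars
  | .star γ => γ.vars
  | .capture x γ => insert x γ.vars

/-- `Parse s γ i j c`: there is a parse of the substring `σ_i ⋯ σ_{j-1}` of `s` by `γ`, and `c` is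
the list of all captures (variable, span) that are made in it. -/
inductive Parse {A : Type u} {V : Type v} (s : List A) :
    Regex A V → ℕ → ℕ → List (V × Span) → Prop
  | epsilon {i : ℕ} : 1 ≤ i → i ≤ s.length + 1 → Parse s .epsilon i i []
  | letter {i : ℕ} {σ : A} : 1 ≤ i → s[i - 1]? = some σ → Parse s (.letter σ) i (i + 1) []
  | altLeft {γ₁ γ₂ : Regex A V} {i j : ℕ} {c : List (V × Span)} :
      Parse s γ₁ i j c → Parse s (.alt γ₁ γ₂) i j c
  | altRight {γ₁ γ₂ : Regex A V} {i j : ℕ} {c : List (V × Span)} :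
      Parse s γ₂ i j c → Parse s (.alt γ₁ γ₂) i j c
  | concat {γ₁ γ₂ : Regex A V} {i j k : ℕ} {c₁ c₂ : List (V × Span)} :
      Parse s γ₁ i j c₁ → Parse s γ₂ j k c₂ → Parse s (.concat γ₁ γ₂) i k (c₁ ++ c₂)
  | starNil {γ : Regex A V} {i : ℕ} : 1 ≤ i → i ≤ s.length + 1 → Parse s (.star γ) i i []
  | starCons {γ : Regex A V} {i j k : ℕ} {c₁ c₂ : List (V × Span)} :
      Parse s γ i j c₁ → Parse s (.star γ) j k c₂ → Parse s (.star γ) i k (c₁ ++ c₂)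
  | capture {x : V} {γ : Regex A V} {i j : ℕ} {c : List (V × Span)} (p : Span) :
      p.left = i → p.right = j → Parse s γ i j c → Parse s (.capture x γ) i j ((x, p) :: c)

theorem Parse.bound {A : Type u} {V : Type v} {s : List A} {γ : Regex A V} {i j : ℕ}
    {c : List (V × Span)} (h : Parse s γ i j c) : j ≤ s.length + 1 := by
  induction h with
  | letter h₁ h₂ =>
    obtain ⟨h, -⟩ := List.getElem?_eq_some_iff.1 h₂
    omega
  | _ => assumption

theorem Parse.mem_captures {A : Type u} {V : Type v} [DecidableEq V] {s : List A}
    {γ : Regex A V} {i j : ℕ} {c : List (V × Span)} (h : Parse s γ i j c) :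
    ∀ q ∈ c, q.1 ∈ γ.vars ∧ q.2.IsSpanOf s := by
  induction h with
  | epsilon => simp
  | letter => simp
  | altLeft _ ih =>
    exact fun q hq => ⟨Finset.mem_union_left _ (ih q hq).1, (ih q hq).2⟩
  | altRight _ ih =>
    exact fun q hq => ⟨Finset.mem_union_right _ (ih q hq).1, (ih q hq).2⟩
  | concat _ _ ih₁ ih₂ =>
    intro q hq
    rcases List.mem_append.1 hq with hq | hq
    · exact ⟨Finset.mem_union_left _ (ih₁ q hq).1, (ih₁ q hq).2⟩
    · exact ⟨Finset.mem_union_right _ (ih₂ q hq).1, (ih₂ q hq).2⟩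
  | starNil => simp
  | starCons _ _ ih₁ ih₂ =>
    intro q hq
    rcases List.mem_append.1 hq with hq | hq
    · exact ih₁ q hq
    · exact ih₂ q hq
  | capture p hi hj h ih =>
    intro q hq
    rcases List.mem_cons.1 hq with rfl | hq
    · exact ⟨Finset.mem_insert_self _ _, show p.right ≤ s.length + 1 from hj ▸ h.bound⟩
    · exact ⟨Finset.mem_insert_of_mem (ih q hq).1, (ih q hq).2⟩

/-- `γ` is functional: every parse of every (whole) string assigns exactly one span to each
variable of `γ`. -/
def Regex.Functional {A : Type u} {V : Type v} [DecidableEq V] (γ : Regex A V) : Prop :=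
  ∀ (s : List A) (c : List (V × Span)), Parse s γ 1 (s.length + 1) c →
    ∀ x ∈ γ.vars, (c.map Prod.fst).count x = 1

/-- Regex formulas, that is, functional regular expressions with capture variables. -/
structure RGX (A : Type u) (V : Type v) [DecidableEq V] where
  regex : Regex A V
  functional : regex.Functional

/-- The spanner defined by a regex formula: its records are those given by the parses of the
whole string. -/
def RGX.toSpanner {A : Type u} {V : Type v} [DecidableEq V] (γ : RGX A V) : Spanner A V where
  vars := γ.regex.vars
  rel s := {r | ∃ c, Parse s γ.regex 1 (s.length + 1) c ∧ ∀ x p, r x = some p ↔ (x, p) ∈ c}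
  isRecord := by
    rintro s r ⟨c, hc, hr⟩
    refine ⟨fun x => ⟨fun hx => ?_, fun hx => ?_⟩, fun x p hx => ?_⟩
    · obtain ⟨p, hp⟩ := Option.isSome_iff_exists.1 hx
      exact (hc.mem_captures _ ((hr x p).1 hp)).1
    · have h1 : x ∈ c.map Prod.fst :=
        List.count_pos_iff.1 (by rw [γ.functional s c hc x hx]; exact Nat.one_pos)
      obtain ⟨⟨y, p⟩, hq, rfl⟩ := List.mem_map.1 h1
      exact Option.isSome_iff_exists.2 ⟨p, (hr y p).2 hq⟩
    · exact (hc.mem_captures _ ((hr x p).1 hx)).2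

/-! ### Generalized core spanners -/

/-- The generalized core spanners: the closure of the spanners of regex formulas under union,
projection, natural join, string-equality selection and difference. -/
inductive IsGeneralizedCore {A : Type u} {V : Type v} [DecidableEq V] : Spanner A V → Prop
  | rgx (γ : RGX A V) : IsGeneralizedCore γ.toSpanner
  | union {P₁ P₂ : Spanner A V} (h : P₁.vars = P₂.vars) :
      IsGeneralizedCore P₁ → IsGeneralizedCore P₂ → IsGeneralizedCore (P₁.union P₂ h)
  | proj {P : Spanner A V} (Y : Finset V) (hY : Y ⊆ P.vars) :
      IsGeneralizedCore P → IsGeneralizedCore (P.proj Y hY)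
  | join {P₁ P₂ : Spanner A V} :
      IsGeneralizedCore P₁ → IsGeneralizedCore P₂ → IsGeneralizedCore (P₁.join P₂)
  | selectEq {P : Spanner A V} (x y : V) (hx : x ∈ P.vars) (hy : y ∈ P.vars) :
      IsGeneralizedCore P → IsGeneralizedCore (P.selectEq x y hx hy)
  | diff {P₁ P₂ : Spanner A V} (h : P₁.vars = P₂.vars) :
      IsGeneralizedCore P₁ → IsGeneralizedCore P₂ → IsGeneralizedCore (P₁.diff P₂ h)

/-! ### RGXlog: Datalog over regex formulas -/

/-- Atoms `R(x₁, …, x_k)` over a signature; variables may be repeated. -/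
structure Atom {Rel : Type} (arity : Rel → ℕ) (V : Type v) where
  rel : Rel
  args : Fin (arity rel) → V

/-- A member of the body of a rule: an atom over the signature or a regex formula. -/
inductive Literal (A : Type u) {Rel : Type} (arity : Rel → ℕ) (V : Type v) [DecidableEq V] :
    Type (max u v)
  | idb (α : Atom arity V) : Literal A arity V
  | rgx (γ : RGX A V) : Literal A arity V

/-- The variable `x` occurs in a member of a body. -/
def Literal.Occurs {A : Type u} {Rel : Type} {arity : Rel → ℕ} {V : Type v} [DecidableEq V]
    (x : V) : Literal A arity V → Prop
  | .idb α => ∃ i, α.args i = x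
  | .rgx γ => x ∈ γ.regex.vars

/-- Rules; each variable of the head occurs in the body. -/
structure Rule (A : Type u) {Rel : Type} (arity : Rel → ℕ) (V : Type v) [DecidableEq V] where
  head : Atom arity V
  body : List (Literal A arity V)
  safe : ∀ i, ∃ ψ ∈ body, ψ.Occurs (head.args i)

/-- RGXlog programs: a finite signature `Rel` of relation symbols with arities, a finite set of
rules, an output symbol `out`, and a sequence `outVars` of distinct variables. -/
structure RGXlog (A : Type u) (V : Type v) [DecidableEq V] where
  Rel : Type
  finite_rel : Finite Rel
  arity : Rel → ℕ
  rules : Set (Rule A arity V)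
  finite_rules : rules.Finite
  out : Rel
  outVars : Fin (arity out) → V
  outVars_injective : Function.Injective outVars

/-- An instantiation of every relation symbol by a set of tuples of spans. -/
abbrev Database {Rel : Type} (arity : Rel → ℕ) := ∀ R : Rel, Set (Fin (arity R) → Span)

/-- The truth of a body member on the string `s` and the database `D` under an assignment `a` of
spans to the variables. -/
def Literal.Holds {A : Type u} {Rel : Type} {arity : Rel → ℕ} {V : Type v} [DecidableEq V]
    (s : List A) (D : Database arity) (a : V → Span) : Literal A arity V → Prop
  | .idb α => (fun i => a (α.args i)) ∈ D α.rel
  | .rgx γ => Record.restrict (fun x => some (a x)) γ.regex.vars ∈ γ.toSpanner.rel s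

namespace RGXlog

variable {A : Type u} {V : Type v} [DecidableEq V]

/-- The database `D` satisfies all rules of `Q` on the string `s`, read as implications with all
variables universally quantified. -/
def Satisfies (Q : RGXlog A V) (s : List A) (D : Database Q.arity) : Prop :=
  ∀ ρ ∈ Q.rules, ∀ a : V → Span, (∀ ψ ∈ ρ.body, ψ.Holds s D a) →
    (fun i => a (ρ.head.args i)) ∈ D ρ.head.rel

/-- The result `Q(s)`: the least database that satisfies all rules of `Q` on `s`
(see `eval_isLeast` and `eval_finite`). -/
def eval (Q : RGXlog A V) (s : List A) : Database Q.arity :=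
  fun R => {t | ∀ D, Q.Satisfies s D → t ∈ D R}

theorem eval_isLeast (Q : RGXlog A V) (s : List A) :
    IsLeast {D | Q.Satisfies s D} (Q.eval s) := by
  refine ⟨fun ρ hρ a h D hD => hD ρ hρ a fun ψ hψ => ?_, fun D hD R t ht => ht D hD⟩
  have h' := h ψ hψ
  cases ψ with
  | idb α => exact h' D hD
  | rgx γ => exact h'

theorem eval_isSpanOf (Q : RGXlog A V) (s : List A) (R : Q.Rel) :
    ∀ t ∈ Q.eval s R, ∀ i, (t i).IsSpanOf s := by
  intro t ht
  refine ht (fun _ => {t | ∀ i, (t i).IsSpanOf s}) fun ρ _ a h i => ?_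
  obtain ⟨ψ, hψ, hi⟩ := ρ.safe i
  have h' := h ψ hψ
  cases ψ with
  | idb α =>
    obtain ⟨j, hj⟩ := hi
    have h'' : (a (α.args j)).IsSpanOf s := h' j
    rw [hj] at h''
    exact h''
  | rgx γ =>
    refine (γ.toSpanner.isRecord s _ h').2 (ρ.head.args i) _ ?_
    have hi' : ρ.head.args i ∈ γ.regex.vars := hi
    simp [Record.restrict, hi']

theorem eval_finite (Q : RGXlog A V) (s : List A) (R : Q.Rel) : (Q.eval s R).Finite := by
  have h1 : {p : Span | p.IsSpanOf s}.Finite := by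
    refine Set.Finite.of_finite_image (f := fun p : Span => (p.left, p.right))
      (((Set.finite_Iic (s.length + 1)).prod (Set.finite_Iic (s.length + 1))).subset ?_) ?_
    · rintro _ ⟨p, hp, rfl⟩
      exact ⟨p.left_le_right.trans hp, hp⟩
    · intro p _ q _ hpq
      exact Span.ext (congrArg Prod.fst hpq) (congrArg Prod.snd hpq)
  exact (Set.Finite.pi' fun _ => h1).subset (Q.eval_isSpanOf s R)

/-- The spanner defined by a program: the tuples of the output relation of `Q(s)`, as
assignments to the output variables. -/
def toSpanner (Q : RGXlog A V) : Spanner A V where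
  vars := Finset.univ.image Q.outVars
  rel s := {r | ∃ t ∈ Q.eval s Q.out, (∀ i, r (Q.outVars i) = some (t i)) ∧
    ∀ x, x ∉ Set.range Q.outVars → r x = none}
  isRecord := by
    rintro s r ⟨t, ht, hr, hn⟩
    refine ⟨fun x => ?_, fun x p hx => ?_⟩
    · by_cases hx : x ∈ Set.range Q.outVars
      · obtain ⟨i, rfl⟩ := hx
        simp [hr]
      · rw [hn x hx]
        simpa using hx
    · by_cases hx' : x ∈ Set.range Q.outVars
      · obtain ⟨i, rfl⟩ := hx'
        rw [hr i] at hx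
        exact Option.some.inj hx ▸ Q.eval_isSpanOf s Q.out t ht i
      · rw [hn x hx'] at hx
        exact absurd hx (by simp)

end RGXlog

/-- The language of all strings whose length is a power of two. -/
def powTwoLanguage (A : Type u) : Language A := {s : List A | ∃ n : ℕ, s.length = 2 ^ n}

end DocSpanner

/-!
The theorem rests on one structural fact: relations between positions of words that are closed under
first-order definitions, that include equality of the lengths of factors, and that are closed under
Kleene star (a `DefinabilityClass`) contain, for each generalized core spanner, the relation between
the ends of the spans in its records (`IsGeneralizedCore.memEnds`). The operations of the spanner
algebra are first-order, with differences as negations and projections as existential quantifiers.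
For a regex formula, the parses that capture each variable of a set `X` exactly once
(`ParseWith`) satisfy a recursion on the formula and on `X`, in which star is needed only for
parses without captures. Two definability classes give the two directions.

On the words `aⁿ` over a single letter, the semilinear relations form a definability class
(`semilinearClass`): first-order closure is the theory of semilinear sets in Mathlib, and star
becomes the additive closure of a set of lengths. A Boolean generalized core spanner therefore
recognizes an ultimately periodic set of lengths on these words, and the powers of two are not
ultimately periodic.

The relations that are, together with their complements, computed by RGXlog programs form another
definability class (`rgxlogClass`). Programs can be combined and extended by recursive rules
(`mem_glue_eval_none`, `RGXlogDefinable.lfp`), which yields conjunction, disjunction, existential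
quantification, and universal quantification as a recursion along the positions. RGXlog has no
negation, so the difference of spanners is handled by carrying complements along. The only
complement that is not immediate is that of star; it is obtained from a positive recursion along
the positions (`RGXlogDefinable.noSplit`). Hence each generalized core spanner is defined by a
program (`exists_toSpanner_eq`). Doubling of positions is definable as well, and a recursion over it
defines the powers of two.
-/

namespace DocSpanner

open scoped Computability

/-! ### Factors of a word -/

section Factor

variable {A : Type u}

/-- The factor of `s` between the positions `i` and `j`, where positions are counted from `0` and
lie between the letters. -/
def factor (s : List A) (i j : ℕ) : List A := (s.drop i).take (j - i)

theorem factor_self (s : List A) (i : ℕ) : factor s i i = [] := by simp [factor]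

theorem length_factor {s : List A} {i j : ℕ} (hj : j ≤ s.length) :
    (factor s i j).length = j - i := by
  simp only [factor, List.length_take, List.length_drop]
  omega

theorem factor_append_factor (s : List A) {i j k : ℕ} (h₁ : i ≤ j) (h₂ : j ≤ k) :
    factor s i j ++ factor s j k = factor s i k := by
  obtain ⟨m, rfl⟩ := Nat.exists_eq_add_of_le h₁
  obtain ⟨n, rfl⟩ := Nat.exists_eq_add_of_le h₂
  simp only [factor]
  rw [show i + m + n - i = m + n by omega, show i + m - i = m by omega,
    show i + m + n - (i + m) = n by omega, List.take_add, List.drop_drop]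

theorem exists_factor_eq_of_factor_eq_append {s : List A} {i j : ℕ} (hi : i ≤ j)
    (hj : j ≤ s.length) {x y : List A} (h : factor s i j = x ++ y) :
    i ≤ i + x.length ∧ i + x.length + y.length = j ∧
      factor s i (i + x.length) = x ∧ factor s (i + x.length) j = y := by
  have hlen : x.length + y.length = j - i := by
    rw [← List.length_append, ← h, length_factor hj]
  have hk : i + x.length ≤ j := by omega
  refine ⟨by omega, by omega, ?_⟩
  rw [← factor_append_factor s (Nat.le_add_right i x.length) hk] at h
  exact List.append_inj h (by rw [length_factor (by omega)]; omega)

theorem getElem?_factor {s : List A} {i j m : ℕ} (h : i + m < j) :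
    (factor s i j)[m]? = s[i + m]? := by
  rw [factor, List.getElem?_take_of_lt (by omega), List.getElem?_drop]

theorem factor_succ {s : List A} {i : ℕ} {σ : A} : factor s i (i + 1) = [σ] ↔ s[i]? = some σ := by
  rw [factor, show i + 1 - i = 1 by omega]
  constructor
  · intro h
    have := congrArg (fun l => l[0]?) h
    simpa [List.getElem?_take] using this
  · intro h
    obtain ⟨hi, rfl⟩ := List.getElem?_eq_some_iff.1 h
    rw [List.drop_eq_getElem_cons hi, List.take_succ_cons, List.take_zero]

/-- The relation between positions `i` and `j` that the factor between them lies in `L`. -/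
def FactorMem (L : Language A) (s : List A) (i j : ℕ) : Prop := i ≤ j ∧ factor s i j ∈ L

theorem factorMem_mul {L M : Language A} {s : List A} {i j : ℕ} (hj : j ≤ s.length) :
    FactorMem (L * M) s i j ↔ ∃ k ≤ s.length, FactorMem L s i k ∧ FactorMem M s k j := by
  constructor
  · rintro ⟨hi, h⟩
    obtain ⟨x, hx, y, hy, hxy⟩ := Language.mem_mul.1 h
    obtain ⟨h₁, h₂, h₃, h₄⟩ := exists_factor_eq_of_factor_eq_append hi hj hxy.symm
    exact ⟨i + x.length, by omega, ⟨h₁, h₃.symm ▸ hx⟩, by omega, h₄.symm ▸ hy⟩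
  · rintro ⟨k, -, ⟨h₁, hx⟩, h₂, hy⟩
    exact ⟨h₁.trans h₂, Language.mem_mul.2 ⟨_, hx, _, hy, factor_append_factor s h₁ h₂⟩⟩

/-- Splitting off a last nonempty factor makes membership in `L∗` a recursion on the right end. -/
theorem factorMem_kstar {L : Language A} {s : List A} {i j : ℕ} (hj : j ≤ s.length) :
    FactorMem L∗ s i j ↔ i = j ∨ ∃ k < j, FactorMem L∗ s i k ∧ FactorMem L s k j := by
  constructor
  · rintro ⟨hi, h⟩
    obtain ⟨S, hS, hmem⟩ := Language.mem_kstar_iff_exists_nonempty.1 h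
    rcases List.eq_nil_or_concat S with rfl | ⟨S, y, rfl⟩
    · left
      have := length_factor (i := i) hj
      rw [hS] at this
      simp at this
      omega
    · right
      simp only [List.concat_eq_append, List.flatten_append, List.flatten_cons,
        List.flatten_nil, List.append_nil] at hS
      obtain ⟨h₁, h₂, h₃, h₄⟩ := exists_factor_eq_of_factor_eq_append hi hj hS
      have hy := hmem y (by simp)
      have := List.length_pos_iff.2 hy.2
      refine ⟨_, by omega, ⟨h₁, h₃.symm ▸ Language.join_mem_kstar fun z hz => ?_⟩, by omega,
        h₄.symm ▸ hy.1⟩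
      exact (hmem z (by simp [hz])).1
  · rintro (rfl | ⟨k, hk, ⟨h₁, hx⟩, h₂, hy⟩)
    · exact ⟨le_rfl, factor_self s i ▸ Language.nil_mem_kstar L⟩
    · refine ⟨h₁.trans h₂, ?_⟩
      rw [← factor_append_factor s h₁ h₂]
      obtain ⟨S, hS, hmem⟩ := Language.mem_kstar.1 hx
      refine Language.mem_kstar.2 ⟨S ++ [factor s k j], by simp [hS], fun z hz => ?_⟩
      rcases List.mem_append.1 hz with hz | hz
      · exact hmem z hz
      · rwa [List.mem_singleton.1 hz]

end Factor

/-! ### Classes of relations on positions -/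

/-- A class of relations between positions of words that is closed under first-order definitions
and under Kleene star. A relation with arguments indexed by `W` assigns to each word `s` a
predicate on `W → ℕ`, which matters only at tuples of positions, that is, of numbers
`≤ s.length`; quantifiers range over positions. Closure under star concerns the relations that the
factor between two positions lies in a language. -/
structure DefinabilityClass (A : Type u) where
  Mem : ∀ {W : Type} [Finite W], (List A → (W → ℕ) → Prop) → Prop
  congr : ∀ {W : Type} [Finite W] {G G' : List A → (W → ℕ) → Prop},
    (∀ s v, (∀ x, v x ≤ s.length) → (G s v ↔ G' s v)) → Mem G → Mem G'
  comp : ∀ {W W' : Type} [Finite W] [Finite W'] (f : W → W') {G : List A → (W → ℕ) → Prop},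
    Mem G → Mem (fun s (v : W' → ℕ) => G s (fun x => v (f x)))
  not : ∀ {W : Type} [Finite W] {G : List A → (W → ℕ) → Prop},
    Mem G → Mem (fun s v => ¬ G s v)
  and : ∀ {W : Type} [Finite W] {G G' : List A → (W → ℕ) → Prop},
    Mem G → Mem G' → Mem (fun s v => G s v ∧ G' s v)
  ex : ∀ {W : Type} [Finite W] {G : List A → (W → ℕ) → ℕ → Prop},
    Mem (fun s (v : Option W → ℕ) => G s (fun x => v (some x)) (v none)) →
      Mem (fun s v => ∃ k ≤ s.length, G s v k)
  le : ∀ {W : Type} [Finite W] (x y : W), Mem (fun _ v => v x ≤ v y)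
  first : ∀ {W : Type} [Finite W] (x : W), Mem (fun _ v => v x = 0)
  last : ∀ {W : Type} [Finite W] (x : W), Mem (fun s v => v x = s.length)
  letter : ∀ {W : Type} [Finite W] (σ : A) (x : W), Mem (fun s v => s[v x]? = some σ)
  sameLength : ∀ {W : Type} [Finite W] (a b c d : W),
    Mem (fun _ v => v a ≤ v b ∧ v c ≤ v d ∧ v b + v c = v a + v d)
  star : ∀ L : Language A,
    (∀ {W : Type} [Finite W] (x y : W), Mem (fun s v => FactorMem L s (v x) (v y))) →
      ∀ {W : Type} [Finite W] (x y : W), Mem (fun s v => FactorMem L∗ s (v x) (v y))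

namespace DefinabilityClass

variable {A : Type u} (K : DefinabilityClass A) {W : Type} [Finite W]

theorem or {G G' : List A → (W → ℕ) → Prop} (h : K.Mem G) (h' : K.Mem G') :
    K.Mem (fun s v => G s v ∨ G' s v) :=
  K.congr (fun s v _ => by tauto) (K.not (K.and (K.not h) (K.not h')))

theorem true : K.Mem (fun _ (_ : W → ℕ) => True) := by
  have h : K.Mem (fun _ (_ : W → ℕ) => ∃ k ≤ _, k = 0) := K.ex (K.first none)
  exact K.congr (fun s v _ => by simp) h

theorem false : K.Mem (fun _ (_ : W → ℕ) => False) :=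
  K.congr (fun _ _ _ => by simp) (K.not K.true)

theorem finset_or {ι : Type*} (F : Finset ι) {G : ι → List A → (W → ℕ) → Prop}
    (h : ∀ i ∈ F, K.Mem (G i)) : K.Mem (fun s v => ∃ i ∈ F, G i s v) := by
  classical
  induction F using Finset.induction_on with
  | empty => exact K.congr (fun _ _ _ => by simp) K.false
  | insert i F hi ih =>
    refine K.congr (fun _ _ _ => by simp) (K.or (h i (by simp)) (ih fun j hj => h j (by simp [hj])))

theorem eq (x y : W) : K.Mem (fun _ v => v x = v y) :=
  K.congr (fun _ _ _ => by omega) (K.and (K.le x y) (K.le y x))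

/-- Equality of factors is first-order in terms of equality of lengths: two factors of the same
length are equal if they carry the same letter at corresponding positions. -/
theorem factor_eq [Finite A] (a b c d : W) :
    K.Mem (fun s v => v a ≤ v b ∧ v c ≤ v d ∧ factor s (v a) (v b) = factor s (v c) (v d)) := by
  have := Fintype.ofFinite A
  have key : K.Mem (fun s v => (v a ≤ v b ∧ v c ≤ v d ∧ v b + v c = v a + v d) ∧
      ¬ ∃ i ≤ s.length, ∃ j ≤ s.length,
        ((v a ≤ i ∧ v c ≤ j ∧ i + v c = v a + j) ∧ ¬ v b ≤ i) ∧
        ¬ ∃ σ ∈ (Finset.univ : Finset A), s[i]? = some σ ∧ s[j]? = some σ) := by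
    refine K.and (K.sameLength a b c d) (K.not (K.ex (K.ex (K.and (K.and ?_ ?_) (K.not ?_)))))
    · exact K.sameLength (some (some a)) (some none) (some (some c)) none
    · exact K.not (K.le (some (some b)) (some none))
    · exact K.finset_or _ fun σ _ => K.and (K.letter σ (some none)) (K.letter σ none)
  refine K.congr (fun s v hv => ?_) key
  constructor
  · rintro ⟨⟨h₁, h₂, h₃⟩, h⟩
    refine ⟨h₁, h₂, List.ext_getElem? fun m => ?_⟩
    by_cases hm : v a + m < v b
    · rw [getElem?_factor hm, getElem?_factor (by omega)]
      have := hv b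
      have := hv d
      by_contra hne
      refine h ⟨v a + m, by omega, v c + m, by omega, ⟨⟨by omega, by omega, by omega⟩,
        by omega⟩, ?_⟩
      rintro ⟨σ, -, h₅, h₆⟩
      exact hne (h₅.trans h₆.symm)
    · have := length_factor (i := v a) (hv b)
      have := length_factor (i := v c) (hv d)
      rw [List.getElem?_eq_none (by omega), List.getElem?_eq_none (by omega)]
  · rintro ⟨h₁, h₂, h⟩
    have hl := congrArg List.length h
    rw [length_factor (hv b), length_factor (hv d)] at hl
    refine ⟨⟨h₁, h₂, by omega⟩, ?_⟩
    rintro ⟨i, hi, j, hj, ⟨⟨h₃, h₄, h₅⟩, h₆⟩, h₇⟩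
    have hb := hv b
    have h₈ : s[i]? = s[j]? := by
      have h₉ := getElem?_factor (s := s) (i := v a) (j := v b) (m := i - v a) (by omega)
      have h₁₀ := getElem?_factor (s := s) (i := v c) (j := v d) (m := i - v a) (by omega)
      rw [h, h₁₀, show v c + (i - v a) = j by omega, show v a + (i - v a) = i by omega] at h₉
      exact h₉.symm
    refine h₇ ⟨s[i]'(by omega), Finset.mem_univ _, List.getElem?_eq_getElem _, ?_⟩
    rw [← h₈]
    exact List.getElem?_eq_getElem _

end DefinabilityClass

/-! ### Parses of regex formulas -/

section Parse

variable {A : Type u} {V : Type v}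

theorem Parse.one_le {s : List A} {γ : Regex A V} {i j : ℕ} {c : List (V × Span)}
    (h : Parse s γ i j c) : 1 ≤ i ∧ i ≤ j := by
  induction h <;> omega

theorem Parse.star_append {s : List A} {γ : Regex A V} {i j k : ℕ} {c d : List (V × Span)}
    (h : Parse s (.star γ) i j c) (h' : Parse s (.star γ) j k d) :
    Parse s (.star γ) i k (c ++ d) := by
  generalize hγ : Regex.star γ = γ' at h
  induction h with
  | starNil =>
    cases hγ
    exact h'
  | starCons h₁ _ _ ih =>
    cases hγ
    rw [List.append_assoc]
    exact .starCons h₁ (ih h' rfl)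
  | _ => cases hγ

theorem parse_empty {s : List A} {i j : ℕ} {c : List (V × Span)} :
    ¬ Parse s (.empty : Regex A V) i j c := nofun

theorem parse_epsilon {s : List A} {i j : ℕ} {c : List (V × Span)} :
    Parse s (.epsilon : Regex A V) i j c ↔ 1 ≤ i ∧ i ≤ s.length + 1 ∧ j = i ∧ c = [] := by
  constructor
  · rintro (⟨h₁, h₂⟩)
    exact ⟨h₁, h₂, rfl, rfl⟩
  · rintro ⟨h₁, h₂, rfl, rfl⟩
    exact .epsilon h₁ h₂

theorem parse_letter {s : List A} {σ : A} {i j : ℕ} {c : List (V × Span)} :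
    Parse s (.letter σ : Regex A V) i j c ↔
      1 ≤ i ∧ s[i - 1]? = some σ ∧ j = i + 1 ∧ c = [] := by
  constructor
  · rintro (⟨h₁, h₂⟩)
    exact ⟨‹_›, ‹_›, rfl, rfl⟩
  · rintro ⟨h₁, h₂, rfl, rfl⟩
    exact .letter h₁ h₂

theorem parse_alt {s : List A} {γ₁ γ₂ : Regex A V} {i j : ℕ} {c : List (V × Span)} :
    Parse s (.alt γ₁ γ₂) i j c ↔ Parse s γ₁ i j c ∨ Parse s γ₂ i j c := by
  constructor
  · intro h
    cases h with
    | altLeft h => exact .inl h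
    | altRight h => exact .inr h
  · rintro (h | h)
    exacts [.altLeft h, .altRight h]

theorem parse_concat {s : List A} {γ₁ γ₂ : Regex A V} {i k : ℕ} {c : List (V × Span)} :
    Parse s (.concat γ₁ γ₂) i k c ↔
      ∃ j c₁ c₂, Parse s γ₁ i j c₁ ∧ Parse s γ₂ j k c₂ ∧ c = c₁ ++ c₂ := by
  constructor
  · intro h
    cases h with
    | concat h₁ h₂ => exact ⟨_, _, _, h₁, h₂, rfl⟩
  · rintro ⟨j, c₁, c₂, h₁, h₂, rfl⟩
    exact .concat h₁ h₂

theorem parse_capture {s : List A} {x : V} {γ : Regex A V} {i j : ℕ} {c : List (V × Span)} :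
    Parse s (.capture x γ) i j c ↔
      ∃ p c', p.left = i ∧ p.right = j ∧ Parse s γ i j c' ∧ c = (x, p) :: c' := by
  constructor
  · intro h
    cases h with
    | capture p h₁ h₂ h₃ => exact ⟨p, _, h₁, h₂, h₃, rfl⟩
  · rintro ⟨p, c', h₁, h₂, h₃, rfl⟩
    exact .capture p h₁ h₂ h₃

/-- The words that a regular expression matches without making a capture. -/
def Regex.captureFree : Regex A V → Language A
  | .empty => 0
  | .epsilon => 1
  | .letter σ => {[σ]}
  | .alt γ₁ γ₂ => γ₁.captureFree + γ₂.captureFree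
  | .concat γ₁ γ₂ => γ₁.captureFree * γ₂.captureFree
  | .star γ => γ.captureFree∗
  | .capture _ _ => 0

/-- Whether a part of `s` has a parse without captures depends only on the factor there. -/
theorem parse_nil_iff {s : List A} {γ : Regex A V} {i j : ℕ} (hj : j ≤ s.length) :
    Parse s γ (i + 1) (j + 1) [] ↔ FactorMem γ.captureFree s i j := by
  induction γ generalizing i j with
  | empty => exact iff_of_false parse_empty fun h => h.2
  | epsilon =>
    rw [parse_epsilon]
    constructor
    · rintro ⟨-, -, h, -⟩
      obtain rfl : j = i := by omega
      exact ⟨le_rfl, factor_self s j⟩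
    · rintro ⟨h, h'⟩
      have := length_factor (i := i) hj
      rw [(Language.mem_one _).1 h', List.length_nil] at this
      exact ⟨by omega, by omega, by omega, rfl⟩
  | letter σ =>
    rw [parse_letter]
    constructor
    · rintro ⟨-, h, h', -⟩
      obtain rfl : j = i + 1 := by omega
      exact ⟨by omega, factor_succ.2 h⟩
    · rintro ⟨h, h'⟩
      have h' : factor s i j = [σ] := h'
      have := length_factor (i := i) hj
      rw [h', List.length_singleton] at this
      obtain rfl : j = i + 1 := by omega
      exact ⟨by omega, factor_succ.1 h', rfl, rfl⟩
  | alt γ₁ γ₂ ih₁ ih₂ =>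
    rw [parse_alt, ih₁ hj, ih₂ hj, FactorMem, FactorMem, FactorMem, Regex.captureFree,
      Language.mem_add, and_or_left]
  | concat γ₁ γ₂ ih₁ ih₂ =>
    rw [parse_concat, Regex.captureFree, factorMem_mul hj]
    constructor
    · rintro ⟨k, c₁, c₂, h₁, h₂, h⟩
      obtain ⟨rfl, rfl⟩ := List.append_eq_nil_iff.1 h.symm
      have := h₁.one_le
      have := h₂.one_le
      obtain ⟨k, rfl⟩ := Nat.exists_eq_add_of_le' (show 1 ≤ k by omega)
      exact ⟨k, by omega, (ih₁ (by omega)).1 h₁, (ih₂ hj).1 h₂⟩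
    · rintro ⟨k, hk, h₁, h₂⟩
      exact ⟨k + 1, [], [], (ih₁ hk).2 h₁, (ih₂ hj).2 h₂, rfl⟩
  | star γ ih =>
    rw [Regex.captureFree]
    constructor
    · intro h
      generalize hγ : Regex.star γ = γ' at h
      generalize hc : ([] : List (V × Span)) = c at h
      generalize hi' : i + 1 = i' at h
      generalize hj' : j + 1 = j' at h
      induction h generalizing i with
      | starNil =>
        obtain rfl : i = j := by omega
        exact ⟨le_rfl, factor_self s i ▸ Language.nil_mem_kstar _⟩
      | @starCons _ _ k _ _ _ h₁ h₂ _ ih₂ =>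
        cases hγ
        obtain ⟨rfl, rfl⟩ := List.append_eq_nil_iff.1 hc.symm
        have := h₁.one_le
        have := h₂.one_le
        obtain ⟨k, rfl⟩ := Nat.exists_eq_add_of_le' (show 1 ≤ k by omega)
        subst hi' hj'
        obtain ⟨h₃, hx⟩ := (ih (by omega)).1 h₁
        obtain ⟨h₄, hy⟩ := ih₂ rfl rfl rfl rfl
        refine ⟨h₃.trans h₄, ?_⟩
        rw [← factor_append_factor s h₃ h₄]
        obtain ⟨S, hS, hmem⟩ := Language.mem_kstar.1 hy
        refine Language.mem_kstar.2 ⟨factor s i k :: S, by simp [hS], fun z hz => ?_⟩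
        rcases List.mem_cons.1 hz with rfl | hz
        exacts [hx, hmem z hz]
      | _ => cases hγ
    · intro h
      induction j using Nat.strong_induction_on with
      | _ j ih' =>
        rcases (factorMem_kstar hj).1 h with rfl | ⟨k, hk, h₁, h₂⟩
        · exact .starNil (by omega) (by omega)
        · have h₃ := ih' k hk (by omega) h₁
          have h₄ := (ih hj).2 h₂
          exact h₃.star_append (.starCons h₄ (.starNil (by omega) (by omega)))
  | capture x γ =>
    refine iff_of_false (fun h => ?_) fun h => h.2
    obtain ⟨p, c', -, -, -, h⟩ := parse_capture.1 h
    cases h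

/-- There is a parse of the factor of `s` between the positions `i` and `j` by `γ` that captures
each variable in `X` exactly once, `x` with the left end `l x` and the right end `r x`, and that
captures nothing else. -/
def ParseWith (γ : Regex A V) (X : Finset V) (s : List A) (i j : ℕ) (l r : V → ℕ) : Prop :=
  ∃ c, Parse s γ (i + 1) (j + 1) c ∧ (c.map Prod.fst).Nodup ∧
    (∀ x, x ∈ c.map Prod.fst ↔ x ∈ X) ∧
    ∀ q ∈ c, q.2.left = l q.1 + 1 ∧ q.2.right = r q.1 + 1

variable {s : List A} {i j : ℕ} {l r : V → ℕ}

theorem parseWith_empty {X : Finset V} : ¬ ParseWith (.empty : Regex A V) X s i j l r := by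
  rintro ⟨c, h, -⟩
  exact parse_empty h

theorem parseWith_emptyset {γ : Regex A V} (hj : j ≤ s.length) :
    ParseWith γ ∅ s i j l r ↔ FactorMem γ.captureFree s i j := by
  rw [← parse_nil_iff hj]
  constructor
  · rintro ⟨c, h, -, hX, -⟩
    rcases c with - | ⟨q, c⟩
    · exact h
    · simpa using hX q.1
  · intro h
    exact ⟨[], h, by simp, by simp, by simp⟩

theorem parseWith_alt {γ₁ γ₂ : Regex A V} {X : Finset V} :
    ParseWith (.alt γ₁ γ₂) X s i j l r ↔ ParseWith γ₁ X s i j l r ∨ ParseWith γ₂ X s i j l r := by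
  simp only [ParseWith, parse_alt, or_and_right, exists_or]

variable [DecidableEq V]

theorem parseWith_capture {x : V} {γ : Regex A V} {X : Finset V} :
    ParseWith (.capture x γ) X s i j l r ↔
      x ∈ X ∧ l x = i ∧ r x = j ∧ ParseWith γ (X.erase x) s i j l r := by
  constructor
  · rintro ⟨c, h, hn, hX, hc⟩
    obtain ⟨p, c', h₁, h₂, h₃, rfl⟩ := parse_capture.1 h
    have h₄ := hc (x, p) (by simp)
    simp only [List.map_cons, List.nodup_cons] at hn
    simp only [List.map_cons, List.mem_cons] at hX
    simp only at h₄
    refine ⟨(hX x).1 (.inl rfl), by omega, by omega, c', h₃, hn.2, fun y => ?_,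
      fun q hq => hc q (by simp [hq])⟩
    rw [Finset.mem_erase, ← hX]
    constructor
    · intro hy
      exact ⟨fun h => hn.1 (h ▸ hy), .inr hy⟩
    · rintro ⟨hne, rfl | hy⟩
      exacts [absurd rfl hne, hy]
  · rintro ⟨hx, rfl, rfl, c, h, hn, hX, hc⟩
    have := h.one_le
    refine ⟨_, .capture ⟨l x + 1, r x + 1, by omega, by omega⟩ rfl rfl h, ?_, fun y => ?_, ?_⟩
    · simp only [List.map_cons, List.nodup_cons, hX]
      exact ⟨Finset.notMem_erase _ _, hn⟩
    · simp only [List.map_cons, List.mem_cons, hX, Finset.mem_erase]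
      by_cases hyx : y = x
      · simp [hyx, hx]
      · simp [hyx]
    · intro q hq
      rcases List.mem_cons.1 hq with rfl | hq
      exacts [⟨rfl, rfl⟩, hc q hq]

/-- Consecutive parses that capture disjoint sets of variables combine to a parse that captures
their union, and each parse of a product arises in this way. -/
theorem captures_append_iff {c₁ c₂ : List (V × Span)} {X : Finset V} :
    (((c₁ ++ c₂).map Prod.fst).Nodup ∧ (∀ x, x ∈ (c₁ ++ c₂).map Prod.fst ↔ x ∈ X) ∧
      ∀ q ∈ c₁ ++ c₂, q.2.left = l q.1 + 1 ∧ q.2.right = r q.1 + 1) ↔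
    ∃ Y ∈ X.powerset,
      ((c₁.map Prod.fst).Nodup ∧ (∀ x, x ∈ c₁.map Prod.fst ↔ x ∈ Y) ∧
        ∀ q ∈ c₁, q.2.left = l q.1 + 1 ∧ q.2.right = r q.1 + 1) ∧
      ((c₂.map Prod.fst).Nodup ∧ (∀ x, x ∈ c₂.map Prod.fst ↔ x ∈ X \ Y) ∧
        ∀ q ∈ c₂, q.2.left = l q.1 + 1 ∧ q.2.right = r q.1 + 1) := by
  simp only [List.map_append, List.nodup_append, List.mem_append]
  constructor
  · rintro ⟨⟨h₁, h₂, h₃⟩, hX, hc⟩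
    refine ⟨(c₁.map Prod.fst).toFinset, ?_, ⟨h₁, fun x => by simp, fun q hq => hc q (.inl hq)⟩,
      h₂, fun x => ?_, fun q hq => hc q (.inr hq)⟩
    · rw [Finset.mem_powerset]
      intro x hx
      exact (hX x).1 (.inl (List.mem_toFinset.1 hx))
    · rw [Finset.mem_sdiff, List.mem_toFinset, ← hX]
      exact ⟨fun hx => ⟨.inr hx, fun hx' => h₃ x hx' x hx rfl⟩, fun hx => hx.1.resolve_left hx.2⟩
  · rintro ⟨Y, hY, ⟨h₁, hY₁, hc₁⟩, h₂, hY₂, hc₂⟩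
    rw [Finset.mem_powerset] at hY
    refine ⟨⟨h₁, h₂, ?_⟩, fun x => ?_, ?_⟩
    · rintro x hx y hy rfl
      rw [hY₁] at hx
      rw [hY₂, Finset.mem_sdiff] at hy
      exact hy.2 hx
    · rw [hY₁, hY₂, Finset.mem_sdiff]
      have := @hY x
      tauto
    · rintro q (hq | hq)
      exacts [hc₁ q hq, hc₂ q hq]

theorem parseWith_concat {γ₁ γ₂ : Regex A V} {X : Finset V} :
    ParseWith (.concat γ₁ γ₂) X s i j l r ↔
      ∃ Y ∈ X.powerset, ∃ k ≤ s.length,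
        ParseWith γ₁ Y s i k l r ∧ ParseWith γ₂ (X \ Y) s k j l r := by
  constructor
  · rintro ⟨c, h, hc⟩
    obtain ⟨k, c₁, c₂, h₁, h₂, rfl⟩ := parse_concat.1 h
    obtain ⟨Y, hY, hc₁, hc₂⟩ := captures_append_iff.1 hc
    have := h₁.one_le
    have := h₁.bound
    obtain ⟨k, rfl⟩ := Nat.exists_eq_add_of_le' (show 1 ≤ k by omega)
    exact ⟨Y, hY, k, by omega, ⟨c₁, h₁, hc₁⟩, c₂, h₂, hc₂⟩
  · rintro ⟨Y, hY, k, hk, ⟨c₁, h₁, hc₁⟩, c₂, h₂, hc₂⟩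
    exact ⟨c₁ ++ c₂, .concat h₁ h₂, captures_append_iff.2 ⟨Y, hY, hc₁, hc₂⟩⟩

/-- A parse by `γ∗` that makes a capture consists of iterations without captures, a first iteration
that captures a nonempty set `Y`, and a parse by `γ∗` that captures fewer variables. -/
theorem parseWith_star {γ : Regex A V} {X : Finset V} (hX : X.Nonempty) :
    ParseWith (.star γ) X s i j l r ↔
      ∃ Y ∈ X.powerset.erase ∅, ∃ k ≤ s.length, ∃ k' ≤ s.length,
        ParseWith (.star γ) ∅ s i k l r ∧ ParseWith γ Y s k k' l r ∧
          ParseWith (.star γ) (X \ Y) s k' j l r := by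
  constructor
  · rintro ⟨c, h, hc⟩
    generalize hγ : Regex.star γ = γ' at h
    generalize hi' : i + 1 = i' at h
    generalize hj' : j + 1 = j' at h
    induction h generalizing i with
    | starNil =>
      obtain ⟨x, hx⟩ := hX
      simpa using (hc.2.1 x).2 hx
    | @starCons _ _ k _ c₁ c₂ h₁ h₂ _ ih =>
      cases hγ
      subst hi' hj'
      have := h₁.one_le
      have := h₁.bound
      obtain ⟨k, rfl⟩ := Nat.exists_eq_add_of_le' (show 1 ≤ k by omega)
      rcases List.eq_nil_or_concat c₁ with rfl | ⟨c₁', q, hq⟩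
      · obtain ⟨Y, hY, m, hm, m', hm', ⟨d, h₃, hd⟩, h₄⟩ := ih hc rfl rfl rfl
        exact ⟨Y, hY, m, hm, m', hm', ⟨d, .starCons h₁ h₃, hd⟩, h₄⟩
      · obtain ⟨Y, hY, hc₁, hc₂⟩ := captures_append_iff.1 hc
        refine ⟨Y, Finset.mem_erase.2 ⟨?_, hY⟩, i, by omega, k, by omega,
          ⟨[], .starNil (by omega) (by omega), by simp, by simp, by simp⟩, ⟨c₁, h₁, hc₁⟩,
          c₂, h₂, hc₂⟩
        rintro rfl
        simpa using (hc₁.2.1 q.1).1 (by simp [hq])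
    | _ => cases hγ
  · rintro ⟨Y, hY, k, hk, k', hk', ⟨c, h, hc⟩, ⟨c₁, h₁, hc₁⟩, c₂, h₂, hc₂⟩
    obtain rfl : c = [] := by
      rcases c with - | ⟨q, c⟩
      · rfl
      · simpa using hc.2.1 q.1
    exact ⟨c₁ ++ c₂, h.star_append (.starCons h₁ h₂),
      captures_append_iff.2 ⟨Y, (Finset.mem_erase.1 hY).2, hc₁, hc₂⟩⟩

end Parse

/-! ### Generalized core spanners belong to every definability class -/

section Core

variable {A : Type u} {V : Type v} (K : DefinabilityClass A)

theorem DefinabilityClass.factorMem_captureFree (γ : Regex A V) {W : Type} [Finite W] (x y : W) :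
    K.Mem (fun s v => FactorMem γ.captureFree s (v x) (v y)) := by
  induction γ generalizing W with
  | empty => exact K.congr (fun s v _ => iff_of_false id fun h => h.2) K.false
  | epsilon =>
    refine K.congr (fun s v hv => ?_) (K.eq x y)
    rw [← parse_nil_iff (V := V) (hv y), parse_epsilon]
    have := hv x
    constructor
    · intro h
      exact ⟨by omega, by omega, by omega, rfl⟩
    · rintro ⟨-, -, h, -⟩
      omega
  | letter σ =>
    have h : K.Mem (fun s v => s[v x]? = some σ ∧ (¬ v y ≤ v x) ∧ ¬ ∃ k ≤ s.length,
        ¬ k ≤ v x ∧ ¬ v y ≤ k) :=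
      K.and (K.letter σ x) (K.and (K.not (K.le y x)) (K.not (K.ex
        (K.and (K.not (K.le none (some x))) (K.not (K.le (some y) none))))))
    refine K.congr (fun s v hv => ?_) h
    rw [← parse_nil_iff (V := V) (hv y), parse_letter]
    have := hv x
    constructor
    · rintro ⟨h₁, h₂, h₃⟩
      refine ⟨by omega, h₁, ?_, rfl⟩
      by_contra hne
      have := hv y
      exact h₃ ⟨v x + 1, by omega, by omega, by omega⟩
    · rintro ⟨-, h₁, h₂, -⟩
      refine ⟨h₁, by omega, ?_⟩
      rintro ⟨k, -, hk⟩
      omega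
  | alt γ₁ γ₂ ih₁ ih₂ =>
    refine K.congr (fun s v hv => ?_) (K.or (ih₁ x y) (ih₂ x y))
    simp only [FactorMem, Regex.captureFree, Language.mem_add, and_or_left]
  | concat γ₁ γ₂ ih₁ ih₂ =>
    have h : K.Mem (fun s v => ∃ k ≤ s.length, FactorMem γ₁.captureFree s (v x) k ∧
        FactorMem γ₂.captureFree s k (v y)) :=
      K.ex (K.and (ih₁ (some x) none) (ih₂ none (some y)))
    exact K.congr (fun s v hv => (factorMem_mul (hv y)).symm) h
  | star γ ih => exact K.star _ ih x y
  | capture => exact K.congr (fun s v _ => iff_of_false id fun h => h.2) K.false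

variable [DecidableEq V]

/-- For `γ∗`, the induction on `γ` is combined with an induction on the set of captured variables;
only parses of `γ∗` without captures need closure under star. -/
theorem DefinabilityClass.parseWith (γ : Regex A V) (X : Finset V) {W : Type} [Finite W]
    (i j : W) (l r : V → W) :
    K.Mem (fun s v => ParseWith γ X s (v i) (v j) (fun x => v (l x)) (fun x => v (r x))) := by
  have hempty : ∀ (γ : Regex A V) {W : Type} [Finite W] (i j : W) (l r : V → W),
      K.Mem (fun s v => ParseWith γ ∅ s (v i) (v j) (fun x => v (l x)) (fun x => v (r x))) :=
    fun γ W _ i j l r => K.congr (fun s v hv => (parseWith_emptyset (hv j)).symm)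
      (K.factorMem_captureFree γ i j)
  induction γ generalizing X W with
  | empty => exact K.congr (fun s v _ => iff_of_false id parseWith_empty) K.false
  | epsilon =>
    rcases X.eq_empty_or_nonempty with rfl | ⟨x, hx⟩
    · exact hempty _ i j l r
    · refine K.congr (fun s v _ => iff_of_false id ?_) K.false
      rintro ⟨c, h, -, hX, -⟩
      obtain ⟨-, -, -, rfl⟩ := parse_epsilon.1 h
      simpa using (hX x).2 hx
  | letter σ =>
    rcases X.eq_empty_or_nonempty with rfl | ⟨x, hx⟩
    · exact hempty _ i j l r
    · refine K.congr (fun s v _ => iff_of_false id ?_) K.false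
      rintro ⟨c, h, -, hX, -⟩
      obtain ⟨-, -, -, rfl⟩ := parse_letter.1 h
      simpa using (hX x).2 hx
  | alt γ₁ γ₂ ih₁ ih₂ =>
    exact K.congr (fun s v _ => parseWith_alt.symm) (K.or (ih₁ X i j l r) (ih₂ X i j l r))
  | concat γ₁ γ₂ ih₁ ih₂ =>
    have h : K.Mem (fun s v => ∃ Y ∈ X.powerset, ∃ k ≤ s.length,
        ParseWith γ₁ Y s (v i) k (fun x => v (l x)) (fun x => v (r x)) ∧
        ParseWith γ₂ (X \ Y) s k (v j) (fun x => v (l x)) (fun x => v (r x))) :=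
      K.finset_or _ fun Y _ => K.ex (K.and
        (ih₁ Y (some i) none (fun x => some (l x)) (fun x => some (r x)))
        (ih₂ (X \ Y) none (some j) (fun x => some (l x)) (fun x => some (r x))))
    exact K.congr (fun s v _ => parseWith_concat.symm) h
  | star γ ih =>
    induction X using Finset.strongInduction generalizing W with
    | _ X ihX =>
      rcases X.eq_empty_or_nonempty with rfl | hX
      · exact hempty _ i j l r
      · have h : K.Mem (fun s v => ∃ Y ∈ X.powerset.erase ∅, ∃ k ≤ s.length, ∃ k' ≤ s.length,
            ParseWith (.star γ) ∅ s (v i) k (fun x => v (l x)) (fun x => v (r x)) ∧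
            ParseWith γ Y s k k' (fun x => v (l x)) (fun x => v (r x)) ∧
            ParseWith (.star γ) (X \ Y) s k' (v j) (fun x => v (l x)) (fun x => v (r x))) := by
          refine K.finset_or _ fun Y hY => K.ex (K.ex (K.and ?_ (K.and ?_ ?_)))
          · exact hempty (.star γ) (some (some i)) (some none) (fun x => some (some (l x)))
              (fun x => some (some (r x)))
          · exact ih Y (some none) none (fun x => some (some (l x)))
              (fun x => some (some (r x)))
          · rw [Finset.mem_erase, Finset.mem_powerset] at hY
            exact ihX (X \ Y)
              (Finset.sdiff_ssubset hY.2 (Finset.nonempty_iff_ne_empty.2 hY.1)) none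
              (some (some j)) (fun x => some (some (l x))) (fun x => some (some (r x)))
        exact K.congr (fun s v _ => (parseWith_star hX).symm) h
  | capture x γ ih =>
    by_cases hx : x ∈ X
    · have h : K.Mem (fun s v => v (l x) = v i ∧ v (r x) = v j ∧ ParseWith γ (X.erase x) s
          (v i) (v j) (fun x => v (l x)) (fun x => v (r x))) :=
        K.and (K.eq _ _) (K.and (K.eq _ _) (ih (X.erase x) i j l r))
      exact K.congr (fun s v _ => by rw [parseWith_capture]; simp [hx]) h
    · exact K.congr (fun s v _ => iff_of_false id fun h => hx (parseWith_capture.1 h).1) K.false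

/-- The record with domain `Y` that assigns to `x` the span between the positions `l x` and `r x`,
where positions are counted from `0`. Its domain is smaller than `Y` if some `r x < l x`. -/
def recordOf (Y : Finset V) (l r : V → ℕ) : Record V := fun x =>
  if h : x ∈ Y ∧ l x ≤ r x then
    some ⟨l x + 1, r x + 1, Nat.le_add_left 1 _, Nat.succ_le_succ h.2⟩ else none

theorem recordOf_eq_some {Y : Finset V} {l r : V → ℕ} {x : V} {p : Span} :
    recordOf Y l r x = some p ↔ x ∈ Y ∧ p.left = l x + 1 ∧ p.right = r x + 1 := by
  unfold recordOf
  split_ifs with h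
  · rw [Option.some_inj]
    constructor
    · rintro rfl
      exact ⟨h.1, rfl, rfl⟩
    · rintro ⟨-, h₁, h₂⟩
      exact Span.ext h₁.symm h₂.symm
  · refine iff_of_false (by simp) ?_
    rintro ⟨h₁, h₂, h₃⟩
    have := p.left_le_right
    exact h ⟨h₁, by omega⟩

theorem restrict_recordOf {Y Z : Finset V} (h : Z ⊆ Y) (l r : V → ℕ) :
    (recordOf Y l r).restrict Z = recordOf Z l r := by
  funext x
  by_cases hx : x ∈ Z
  · simp [Record.restrict, recordOf, hx, h hx]
  · simp [Record.restrict, recordOf, hx]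

theorem IsRecord.le_length {Y : Finset V} {s : List A} {l r : V → ℕ}
    (h : IsRecord Y s (recordOf Y l r)) {x : V} (hx : x ∈ Y) : l x ≤ r x ∧ r x ≤ s.length := by
  obtain ⟨p, hp⟩ := Option.isSome_iff_exists.1 ((h.1 x).2 hx)
  have h₁ := h.2 x p hp
  obtain ⟨-, h₂, h₃⟩ := recordOf_eq_some.1 hp
  have := p.left_le_right
  unfold Span.IsSpanOf at h₁
  omega

theorem isRecord_recordOf {Y : Finset V} {s : List A} {l r : V → ℕ}
    (h : ∀ x ∈ Y, l x ≤ r x ∧ r x ≤ s.length) : IsRecord Y s (recordOf Y l r) := by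
  constructor
  · intro x
    unfold recordOf
    split_ifs with hx
    · simp [hx.1]
    · simp only [Option.isSome_none, Bool.false_eq_true, false_iff]
      exact fun hx' => hx ⟨hx', (h x hx').1⟩
  · intro x p hp
    obtain ⟨h₁, -, h₂⟩ := recordOf_eq_some.1 hp
    have := (h x h₁).2
    unfold Span.IsSpanOf
    omega

theorem IsRecord.exists_eq_recordOf {Y : Finset V} {s : List A} {ρ : Record V}
    (h : IsRecord Y s ρ) :
    ∃ l r : V → ℕ, (∀ x, l x ≤ s.length ∧ r x ≤ s.length) ∧ ρ = recordOf Y l r := by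
  refine ⟨fun x => (ρ x).elim 0 fun p => p.left - 1, fun x => (ρ x).elim 0 fun p => p.right - 1,
    fun x => ?_, ?_⟩
  · dsimp only
    rcases hx : ρ x with - | p
    · simp
    · have h₁ := h.2 x p hx
      unfold Span.IsSpanOf at h₁
      have := p.left_le_right
      simp only [Option.elim_some]
      omega
  · funext x
    have hY := h.1 x
    rcases hx : ρ x with - | p
    · rw [hx] at hY
      have : x ∉ Y := by simpa using hY
      simp [recordOf, this]
    · rw [hx] at hY
      have := p.one_le_left
      have := p.left_le_right
      symm
      rw [recordOf_eq_some]
      simp only [hx, Option.elim_some]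
      exact ⟨hY.1 rfl, by omega, by omega⟩

/-- `F` is in the class, whatever the variables are that stand for the values of `l` and `r`. -/
def DefinabilityClass.MemEnds (F : List A → (V → ℕ) → (V → ℕ) → Prop) : Prop :=
  ∀ {W : Type} [Finite W] (l r : V → W),
    K.Mem (fun s v => F s (fun x => v (l x)) (fun x => v (r x)))

theorem DefinabilityClass.MemEnds.ex_update {K : DefinabilityClass A}
    {F : List A → (V → ℕ) → (V → ℕ) → Prop} (hF : K.MemEnds F) (x : V) :
    K.MemEnds (fun s l r => ∃ a ≤ s.length, ∃ b ≤ s.length,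
      F s (Function.update l x a) (Function.update r x b)) := by
  intro W _ l r
  refine K.ex (K.ex ?_)
  have h := hF (Function.update (fun y => some (some (l y))) x (some none))
    (Function.update (fun y => some (some (r y))) x (none : Option (Option W)))
  refine K.congr (fun s v _ => ?_) h
  refine Eq.to_iff (congrArg₂ (F s) ?_ ?_)
  all_goals
    funext y
    by_cases hy : y = x
    · subst hy; simp
    · simp [hy]

theorem DefinabilityClass.MemEnds.ex_finset {K : DefinabilityClass A}
    {F : List A → (V → ℕ) → (V → ℕ) → Prop} (hF : K.MemEnds F) (Z : Finset V) :
    K.MemEnds (fun s l r => ∃ l' r' : V → ℕ, (∀ x ∉ Z, l' x = l x ∧ r' x = r x) ∧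
      (∀ x ∈ Z, l' x ≤ s.length ∧ r' x ≤ s.length) ∧ F s l' r') := by
  induction Z using Finset.induction_on with
  | empty =>
    intro W _ l r
    refine K.congr (fun s v _ => ⟨fun h => ⟨_, _, by simp, by simp, h⟩, ?_⟩) (hF l r)
    rintro ⟨l', r', h, -, h'⟩
    obtain rfl : l' = fun x => v (l x) := funext fun x => (h x (by simp)).1
    obtain rfl : r' = fun x => v (r x) := funext fun x => (h x (by simp)).2
    exact h'
  | insert z Z hz ih =>
    intro W _ l r
    refine K.congr (fun s v _ => ⟨?_, ?_⟩) (ih.ex_update z l r)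
    · rintro ⟨a, ha, b, hb, l', r', h₁, h₂, h₃⟩
      refine ⟨l', r', fun x hx => ?_, fun x hx => ?_, h₃⟩
      · rw [Finset.mem_insert, not_or] at hx
        simpa [hx.1] using h₁ x hx.2
      · rcases Finset.mem_insert.1 hx with rfl | hx
        · obtain ⟨h₄, h₅⟩ := h₁ x hz
          rw [Function.update_self] at h₄ h₅
          omega
        · exact h₂ x hx
    · rintro ⟨l', r', h₁, h₂, h₃⟩
      have h₄ := h₂ z (Finset.mem_insert_self _ _)
      refine ⟨l' z, h₄.1, r' z, h₄.2, l', r', fun x hx => ?_,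
        fun x hx => h₂ x (Finset.mem_insert_of_mem hx), h₃⟩
      by_cases hxz : x = z
      · subst hxz; simp
      · have := h₁ x (by simp [hx, hxz])
        simpa [hxz] using this

/-- For a functional formula, the parses of the whole word are among those described by
`ParseWith`. -/
theorem RGX.recordOf_mem_iff (γ : RGX A V) {s : List A} {l r : V → ℕ} :
    recordOf γ.regex.vars l r ∈ γ.toSpanner.rel s ↔
      ParseWith γ.regex γ.regex.vars s 0 s.length l r := by
  constructor
  · rintro ⟨c, h, hc⟩
    have hcount := γ.functional s c h
    have hmem : ∀ x, x ∈ c.map Prod.fst ↔ x ∈ γ.regex.vars := fun x => by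
      constructor
      · intro hx
        obtain ⟨q, hq, rfl⟩ := List.mem_map.1 hx
        exact (h.mem_captures q hq).1
      · intro hx
        exact List.count_pos_iff.1 (by rw [hcount x hx]; exact Nat.one_pos)
    refine ⟨c, by rwa [zero_add], List.nodup_iff_count_le_one.2 fun x => ?_, hmem, fun q hq => ?_⟩
    · by_cases hx : x ∈ c.map Prod.fst
      · exact (hcount x ((hmem x).1 hx)).le
      · rw [List.count_eq_zero_of_not_mem hx]
        exact Nat.zero_le 1
    · exact (recordOf_eq_some.1 ((hc q.1 q.2).2 hq)).2
  · rintro ⟨c, h, hn, hX, hc⟩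
    rw [zero_add] at h
    refine ⟨c, h, fun x p => ?_⟩
    rw [recordOf_eq_some]
    constructor
    · rintro ⟨hx, h₁, h₂⟩
      obtain ⟨⟨y, q⟩, hq, rfl⟩ := List.mem_map.1 ((hX x).2 hx)
      obtain ⟨h₃, h₄⟩ := hc _ hq
      obtain rfl : p = q := Span.ext (h₁.trans h₃.symm) (h₂.trans h₄.symm)
      exact hq
    · intro hx
      exact ⟨(hX x).1 (List.mem_map.2 ⟨_, hx, rfl⟩), hc _ hx⟩

/-- Over every definability class, the records of a generalized core spanner form a definable
relation between the ends of their spans. -/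
theorem IsGeneralizedCore.memEnds [Finite A] {P : Spanner A V} (hP : IsGeneralizedCore P) :
    K.MemEnds (fun s l r => recordOf P.vars l r ∈ P.rel s) := by
  induction hP with
  | rgx γ =>
    intro W _ l r
    have h : K.Mem (fun s (v : W → ℕ) => ∃ i ≤ s.length, ∃ j ≤ s.length, (i = 0 ∧ j = s.length) ∧
        ParseWith γ.regex γ.regex.vars s i j (fun x => v (l x)) (fun x => v (r x))) :=
      K.ex (K.ex (K.and (K.and (K.first (some none)) (K.last none))
        (K.parseWith _ _ (some none) none (fun x => some (some (l x)))
          (fun x => some (some (r x))))))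
    refine K.congr (fun s v _ => ?_) h
    refine Iff.trans ?_ γ.recordOf_mem_iff.symm
    constructor
    · rintro ⟨_, -, _, -, ⟨rfl, rfl⟩, h⟩
      exact h
    · intro h
      exact ⟨0, Nat.zero_le _, _, le_rfl, ⟨rfl, rfl⟩, h⟩
  | @union P₁ P₂ h _ _ ih₁ ih₂ =>
    intro W _ l r
    refine K.congr (fun s v _ => ?_) (K.or (ih₁ l r) (ih₂ l r))
    rw [← h]
    exact Iff.rfl
  | @diff P₁ P₂ h _ _ ih₁ ih₂ =>
    intro W _ l r
    refine K.congr (fun s v _ => ?_) (K.and (ih₁ l r) (K.not (ih₂ l r)))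
    rw [← h]
    exact Iff.rfl
  | @proj P Y hY _ ih =>
    intro W _ l r
    refine K.congr (fun s v _ => ?_) (ih.ex_finset (P.vars \ Y) l r)
    constructor
    · rintro ⟨l', r', h₁, -, h₂⟩
      refine ⟨_, h₂, ?_⟩
      rw [restrict_recordOf hY]
      refine funext fun x => Option.ext fun p => ?_
      rw [recordOf_eq_some, recordOf_eq_some]
      refine and_congr_right fun hx : x ∈ Y => ?_
      obtain ⟨h₃, h₄⟩ := h₁ x (by simp [hx])
      rw [h₃, h₄]
    · rintro ⟨ρ, hρ, h⟩
      obtain ⟨l', r', h₁, rfl⟩ := (P.isRecord s ρ hρ).exists_eq_recordOf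
      refine ⟨fun x => if x ∈ P.vars \ Y then l' x else v (l x),
        fun x => if x ∈ P.vars \ Y then r' x else v (r x),
        fun x hx => by simp only [if_neg hx, and_self],
        fun x hx => by simpa only [if_pos hx] using h₁ x, ?_⟩
      convert hρ using 1
      rw [restrict_recordOf hY] at h
      funext x
      by_cases hx : x ∈ Y
      · obtain ⟨p, hp⟩ := Option.isSome_iff_exists.1 (((P.isRecord s _ hρ).1 x).2 (hY hx))
        obtain ⟨-, h₂, h₃⟩ := recordOf_eq_some.1 hp
        have h₄ : recordOf Y l' r' x = some p := recordOf_eq_some.2 ⟨hx, h₂, h₃⟩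
        rw [← h] at h₄
        obtain ⟨-, h₅, h₆⟩ := recordOf_eq_some.1 h₄
        rw [hp, recordOf_eq_some]
        simp only [Finset.mem_sdiff, hx, not_true, and_false, if_false]
        exact ⟨hY hx, h₅, h₆⟩
      · by_cases hx' : x ∈ P.vars
        · simp [recordOf, hx, hx']
        · simp [recordOf, hx']
  | @join P₁ P₂ _ _ ih₁ ih₂ =>
    intro W _ l r
    refine K.congr (fun s v _ => ?_) (K.and (ih₁ l r) (ih₂ l r))
    have h₁ := restrict_recordOf (Y := P₁.vars ∪ P₂.vars) Finset.subset_union_left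
      (fun x => v (l x)) (fun x => v (r x))
    have h₂ := restrict_recordOf (Y := P₁.vars ∪ P₂.vars) Finset.subset_union_right
      (fun x => v (l x)) (fun x => v (r x))
    constructor
    · rintro ⟨h₃, h₄⟩
      refine ⟨isRecord_recordOf fun x hx => ?_, h₁.symm ▸ h₃, h₂.symm ▸ h₄⟩
      rcases Finset.mem_union.1 hx with hx | hx
      · exact (P₁.isRecord s _ h₃).le_length hx
      · exact (P₂.isRecord s _ h₄).le_length hx
    · rintro ⟨-, h₃, h₄⟩
      exact ⟨Set.mem_of_eq_of_mem h₁.symm h₃, Set.mem_of_eq_of_mem h₂.symm h₄⟩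
  | @selectEq P x y hx hy _ ih =>
    intro W _ l r
    refine K.congr (fun s v _ => ?_) (K.and (ih l r) (K.factor_eq (l x) (r x) (l y) (r y)))
    refine and_congr_right fun h => ?_
    have hr := P.isRecord s _ h
    have hsub : ∀ {z : V} {p : Span},
        recordOf P.vars (fun x => v (l x)) (fun x => v (r x)) z = some p →
        p.substring s = factor s (v (l z)) (v (r z)) := by
      intro z p hp
      obtain ⟨-, h₁, h₂⟩ := recordOf_eq_some.1 hp
      rw [Span.substring, factor, h₁, h₂, Nat.add_sub_cancel, Nat.add_sub_add_right]
    constructor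
    · rintro ⟨-, -, h₁⟩
      obtain ⟨p, hp⟩ := Option.isSome_iff_exists.1 ((hr.1 x).2 hx)
      obtain ⟨q, hq⟩ := Option.isSome_iff_exists.1 ((hr.1 y).2 hy)
      exact ⟨p, q, hp, hq, by rw [hsub hp, hsub hq, h₁]⟩
    · rintro ⟨p, q, hp, hq, h₁⟩
      rw [hsub hp, hsub hq] at h₁
      exact ⟨(hr.le_length hx).1, (hr.le_length hy).1, h₁⟩

end Core

/-! ### Semilinear relations on words over one letter -/

section Semilinear

variable {ι : Type} [Finite ι]

theorem isSemilinearSet_setOf_add_eq (x y z w : ι) :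
    IsSemilinearSet {v : ι → ℕ | v x + v y = v z + v w} := by
  have h := isSemilinearSet_setOfPred_eq (M := ι → ℕ) 0 0
    (Pi.evalAddMonoidHom (fun _ => ℕ) x + Pi.evalAddMonoidHom (fun _ => ℕ) y)
    (Pi.evalAddMonoidHom (fun _ => ℕ) z + Pi.evalAddMonoidHom (fun _ => ℕ) w)
  simpa using h

theorem isSemilinearSet_setOf_eq_zero (x : ι) : IsSemilinearSet {v : ι → ℕ | v x = 0} := by
  have h := isSemilinearSet_setOfPred_eq (M := ι → ℕ) 0 0 (Pi.evalAddMonoidHom (fun _ => ℕ) x)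
    (0 : (ι → ℕ) →+ ℕ)
  simpa using h

theorem isSemilinearSet_setOf_sub_mem (x y : ι) {M : Set ℕ} (hM : IsSemilinearSet M) :
    IsSemilinearSet {v : ι → ℕ | v x ≤ v y ∧ v y - v x ∈ M} := by
  have h₁ := isSemilinearSet_setOfPred_eq (M := (ι → ℕ) × ℕ) 0 0
    ((Pi.evalAddMonoidHom (fun _ => ℕ) x).comp (AddMonoidHom.fst _ _) + AddMonoidHom.snd _ _)
    ((Pi.evalAddMonoidHom (fun _ => ℕ) y).comp (AddMonoidHom.fst _ _))
  have h₂ := hM.preimage (AddMonoidHom.snd (ι → ℕ) ℕ)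
  convert (h₁.inter h₂).image (AddMonoidHom.fst (ι → ℕ) ℕ) using 1
  ext v
  simp only [Set.mem_ofPred, Set.mem_image, Set.mem_inter_iff, Set.mem_preimage]
  constructor
  · rintro ⟨h, h'⟩
    exact ⟨(v, v y - v x), ⟨by simp; omega, h'⟩, rfl⟩
  · rintro ⟨⟨v, k⟩, ⟨h, h'⟩, rfl⟩
    simp only [zero_add, AddMonoidHom.add_apply, AddMonoidHom.comp_apply, AddMonoidHom.coe_fst,
      AddMonoidHom.coe_snd, Pi.evalAddMonoidHom_apply] at h h' ⊢
    rw [← h, Nat.add_sub_cancel_left]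
    exact ⟨Nat.le_add_right _ _, h'⟩

theorem isSemilinearSet_setOf_le (x y : ι) : IsSemilinearSet {v : ι → ℕ | v x ≤ v y} := by
  simpa using isSemilinearSet_setOf_sub_mem x y (IsSemilinearSet.univ (M := ℕ))

theorem isSemilinearSet_preimage_comp {κ : Type} [Finite κ] (f : κ → ι) {S : Set (κ → ℕ)}
    (hS : IsSemilinearSet S) : IsSemilinearSet {v : ι → ℕ | (fun x => v (f x)) ∈ S} :=
  hS.preimage (LinearMap.funLeft ℕ ℕ f)

end Semilinear

section Unary

variable {A : Type u}

theorem replicate_mem_kstar {a : A} {L : Language A} {m : ℕ} :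
    List.replicate m a ∈ L∗ ↔ m ∈ AddSubmonoid.closure {k | List.replicate k a ∈ L} := by
  constructor
  · intro h
    obtain ⟨S, hS, hmem⟩ := Language.mem_kstar.1 h
    induction S generalizing m with
    | nil =>
      have := congrArg List.length hS
      simp only [List.length_replicate, List.flatten_nil, List.length_nil] at this
      rw [this]
      exact zero_mem _
    | cons y S ih =>
      rw [List.flatten_cons] at hS
      obtain ⟨hlen, hy, hz⟩ := List.append_eq_replicate_iff.1 hS.symm
      rw [← hlen]
      refine add_mem (AddSubmonoid.subset_closure ?_) (ih ?_ hz.symm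
        fun z hz => hmem z (List.mem_cons_of_mem _ hz))
      · rw [Set.mem_ofPred, ← hy]
        exact hmem y List.mem_cons_self
      · exact Language.mem_kstar.2 ⟨S, hz.symm, fun z hz => hmem z (List.mem_cons_of_mem _ hz)⟩
  · intro h
    induction h using AddSubmonoid.closure_induction with
    | mem k hk => exact Language.mem_kstar.2 ⟨[List.replicate k a], by simp, by simpa using hk⟩
    | zero => exact Language.nil_mem_kstar L
    | add k m _ _ h₁ h₂ =>
      obtain ⟨S, hS, hS'⟩ := Language.mem_kstar.1 h₁
      obtain ⟨T, hT, hT'⟩ := Language.mem_kstar.1 h₂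
      refine Language.mem_kstar.2 ⟨S ++ T, ?_, fun z hz => ?_⟩
      · rw [List.flatten_append, ← hS, ← hT, List.replicate_append_replicate]
      · exact (List.mem_append.1 hz).elim (hS' z) (hT' z)

theorem factorMem_replicate {a : A} {L : Language A} {n i j : ℕ} (hj : j ≤ n) :
    FactorMem L (List.replicate n a) i j ↔ i ≤ j ∧ j - i ∈ {k | List.replicate k a ∈ L} := by
  rw [FactorMem, factor, List.drop_replicate, List.take_replicate, Nat.min_eq_left (by omega)]
  rfl

/-- The tuples `(n, v)` such that `v` is a tuple of positions of `aⁿ` in the relation `G`. -/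
def unarySet (a : A) {W : Type} (G : List A → (W → ℕ) → Prop) : Set (Option W → ℕ) :=
  {v | (∀ x, v (some x) ≤ v none) ∧ G (List.replicate (v none) a) (fun x => v (some x))}

theorem isSemilinearSet_positions (W : Type) [Finite W] :
    IsSemilinearSet {v : Option W → ℕ | ∀ x, v (some x) ≤ v none} := by
  simp only [Set.ofPred_forall]
  exact IsSemilinearSet.iInter fun x => isSemilinearSet_setOf_le (some x) none

/-- On the words `aⁿ`, the semilinear relations form a definability class. -/
def semilinearClass (a : A) : DefinabilityClass A := by
  -- It suffices to find a semilinear set that agrees with `unarySet a G` on tuples of positions.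
  have hset : ∀ {W : Type} [Finite W] {S : Set (Option W → ℕ)}
      {G : List A → (W → ℕ) → Prop}, IsSemilinearSet S →
      (∀ v : Option W → ℕ, (∀ x, v (some x) ≤ v none) →
        (v ∈ S ↔ G (List.replicate (v none) a) (fun x => v (some x)))) →
      IsSemilinearSet (unarySet a G) := by
    intro W _ S G hS h
    convert (isSemilinearSet_positions W).inter hS using 1
    ext v
    exact and_congr_right fun hv => (h v hv).symm
  exact {
    Mem := fun {W} _ G => IsSemilinearSet (unarySet a G)
    congr := fun h hG => hset hG fun v hv => by
      rw [← h _ _ (by simpa using hv)]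
      exact and_iff_right hv
    comp := fun f _ hG => hset (isSemilinearSet_preimage_comp (Option.map f) hG) fun v hv =>
      and_iff_right fun x => hv (f x)
    not := fun hG => hset hG.compl fun v hv => not_congr (and_iff_right hv)
    and := fun hG hG' => hset (hG.inter hG') fun v hv =>
      and_congr (and_iff_right hv) (and_iff_right hv)
    ex := fun {W} _ G hG => by
      refine hset (hG.image (LinearMap.funLeft ℕ ℕ (Option.map some))) fun v hv => ?_
      rw [List.length_replicate]
      constructor
      · rintro ⟨v, ⟨h₁, h₂⟩, rfl⟩
        exact ⟨v (some none), h₁ none, h₂⟩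
      · rintro ⟨k, hk, h⟩
        refine ⟨fun o => o.elim (v none) fun o' => o'.elim k fun x => v (some x), ⟨?_, h⟩, ?_⟩
        · rintro (- | x)
          exacts [hk, hv x]
        · funext o
          cases o <;> rfl
    le := fun x y => hset (isSemilinearSet_setOf_le (some x) (some y)) fun _ _ => Iff.rfl
    first := fun x => hset (isSemilinearSet_setOf_eq_zero (some x)) fun _ _ => Iff.rfl
    last := fun x => hset (isSemilinearSet_setOf_le none (some x)) fun v hv => by
      rw [List.length_replicate]
      exact ⟨fun h => le_antisymm (hv x) h, fun h => h.ge⟩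
    letter := fun {W} _ σ x => by
      by_cases hσ : a = σ
      · refine hset (isSemilinearSet_setOf_le none (some x)).compl fun v _ => ?_
        rw [List.getElem?_replicate]
        simp [hσ]
      · refine hset IsSemilinearSet.empty fun v _ => ?_
        rw [List.getElem?_replicate]
        simp [hσ]
    sameLength := fun p q r t => hset ((isSemilinearSet_setOf_le (some p) (some q)).inter
      ((isSemilinearSet_setOf_le (some r) (some t)).inter
        (isSemilinearSet_setOf_add_eq (some q) (some r) (some p) (some t)))) fun _ _ => Iff.rfl
    star := fun L hL {W} _ x y => by
      have hM : IsSemilinearSet {k | List.replicate k a ∈ L} := by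
        -- The length `k` is in the set if and only if the whole word `aᵏ` is a factor in `L`.
        let f : ℕ →+ (Option Bool → ℕ) :=
          { toFun := fun n o => o.elim n fun b => if b then n else 0
            map_zero' := by ext (- | - | -) <;> rfl
            map_add' := fun m n => by ext (- | - | -) <;> rfl }
        convert (hL (W := Bool) false true).preimage f using 1
        ext n
        have h : FactorMem L (List.replicate n a) 0 n ↔ List.replicate n a ∈ L := by
          rw [factorMem_replicate le_rfl, Nat.sub_zero]
          exact and_iff_right (Nat.zero_le n)
        refine h.symm.trans (and_iff_right ?_).symm
        rintro (- | -)
        exacts [Nat.zero_le n, le_rfl]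
      refine hset (isSemilinearSet_setOf_sub_mem (some x) (some y) hM.closure) fun v hv => ?_
      rw [factorMem_replicate (hv y)]
      exact and_congr_right fun _ => replicate_mem_kstar.symm }

/-- Periodicity with period `p` beyond `k` would relate `2 ^ (k + p)` to `2 ^ (k + p) + p`, which lies strictly
below the next power of two. -/
theorem not_isSemilinearSet_powers_of_two : ¬ IsSemilinearSet {n : ℕ | ∃ m, n = 2 ^ m} := by
  rw [Nat.isSemilinearSet_iff_ultimately_periodic]
  rintro ⟨k, p, hp, h⟩
  have hlt : k + p < 2 ^ (k + p) := Nat.lt_two_pow_self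
  obtain ⟨m, hm⟩ := (h (2 ^ (k + p)) (by omega)).1 ⟨_, rfl⟩
  have h₁ : k + p < m := (Nat.pow_lt_pow_iff_right (by norm_num : 1 < 2)).1 (by omega)
  have h₂ : m < k + p + 1 :=
    (Nat.pow_lt_pow_iff_right (by norm_num : 1 < 2)).1 (by rw [pow_succ]; omega)
  omega

theorem Spanner.mem_rel_of_isBoolean {V : Type v} {P : Spanner A V} (hP : P.IsBoolean)
    {s : List A} {ρ : Record V} (hρ : ρ ∈ P.rel s) : ρ = fun _ => none := by
  funext x
  have h := (P.isRecord s ρ hρ).1 x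
  rw [hP] at h
  simpa using h

theorem Spanner.isTrueOn_iff {V : Type v} {P : Spanner A V} (hP : P.IsBoolean) {s : List A} :
    P.IsTrueOn s ↔ (fun _ => none) ∈ P.rel s :=
  ⟨fun h => h ▸ rfl, fun h => Set.eq_singleton_iff_unique_mem.2
    ⟨h, fun _ hρ => Spanner.mem_rel_of_isBoolean hP hρ⟩⟩

/-- On words over a single letter, a Boolean generalized core spanner is true for a semilinear set
of lengths only. -/
theorem not_recognizes_powTwoLanguage [Finite A] [Nonempty A] {V : Type v} [DecidableEq V]
    {P : Spanner A V} (hP : IsGeneralizedCore P) : ¬ P.Recognizes (powTwoLanguage A) := by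
  rintro ⟨hB, hrec⟩
  obtain ⟨a⟩ := ‹Nonempty A›
  have h : IsSemilinearSet (unarySet a fun s (v : Unit → ℕ) =>
      recordOf P.vars (fun _ => v ()) (fun _ => v ()) ∈ P.rel s) :=
    hP.memEnds (semilinearClass a) (fun _ => ()) (fun _ => ())
  -- The preimage under `n ↦ (n, 0)` reads off the lengths.
  let f : ℕ →+ (Option Unit → ℕ) :=
    { toFun := fun n o => o.elim n fun _ => 0
      map_zero' := by ext (- | -) <;> rfl
      map_add' := fun m n => by ext (- | -) <;> rfl }
  refine not_isSemilinearSet_powers_of_two ?_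
  convert h.preimage f using 1
  ext n
  have h₁ := hrec (List.replicate n a)
  rw [Spanner.isTrueOn_iff hB] at h₁
  have h₂ : recordOf P.vars (fun _ => 0) (fun _ => 0) = fun _ => none := by
    rw [show P.vars = ∅ from hB]
    rfl
  rw [← h₂] at h₁
  have h₃ : (∃ m, (List.replicate n a).length = 2 ^ m) ↔ ∃ m, n = 2 ^ m := by
    rw [List.length_replicate]
  exact (h₃.symm.trans h₁).trans (and_iff_right fun _ => Nat.zero_le n).symm

end Unary

/-! ### Combining programs -/

section Glue

variable {A : Type u} {V : Type v} [DecidableEq V]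

/-- The image of a body member under a map of signatures. -/
def Literal.map {Rel Rel' : Type} {arity : Rel' → ℕ} (f : Rel → Rel') :
    Literal A (fun R => arity (f R)) V → Literal A arity V
  | .idb α => .idb ⟨f α.rel, α.args⟩
  | .rgx γ => .rgx γ

/-- The image of a rule under a map of signatures. -/
def Rule.map {Rel Rel' : Type} {arity : Rel' → ℕ} (f : Rel → Rel')
    (ρ : Rule A (fun R => arity (f R)) V) : Rule A arity V where
  head := ⟨f ρ.head.rel, ρ.head.args⟩
  body := ρ.body.map (Literal.map f)
  safe i := by
    obtain ⟨ψ, hψ, h⟩ := ρ.safe i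
    refine ⟨ψ.map f, List.mem_map_of_mem hψ, ?_⟩
    cases ψ <;> exact h

theorem Literal.map_holds {Rel Rel' : Type} {arity : Rel' → ℕ} (f : Rel → Rel') {s : List A}
    {D : Database arity} {a : V → Span} (ψ : Literal A (fun R => arity (f R)) V) :
    (ψ.map f).Holds s D a ↔ ψ.Holds s (fun R => D (f R)) a := by
  cases ψ <;> exact Iff.rfl

variable {I : Type} (Q : I → RGXlog A V) (k : ℕ)

/-- The arities of the disjoint union of the signatures of the programs `Q i` and one new symbol
`none` of arity `k`. -/
def glueArity : Option (Σ i, (Q i).Rel) → ℕ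
  | none => k
  | some R => (Q R.1).arity R.2

variable {k}

/-- The database over the combined signature that consists of the results of the programs `Q i`
and of the relation `U` for the new symbol. -/
def glueDatabase (s : List A) (U : Set (Fin k → Span)) : Database (glueArity Q k)
  | none => U
  | some R => (Q R.1).eval s R.2

variable {J : Type} [Finite I] [Finite J] (hd : J → Fin k → V)
  (bd : J → List (Literal A (glueArity Q k) V))
  (hsafe : ∀ ρ i, ∃ ψ ∈ bd ρ, ψ.Occurs (hd ρ i)) (outVars : Fin k → V)
  (houtVars : Function.Injective outVars)

/-- The program that consists of all rules of the programs `Q i` and of rules for a new symbol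
`none`, which is the output symbol. The rules of the new symbol have the heads `hd` and the
bodies `bd`. -/
def glue : RGXlog A V where
  Rel := Option (Σ i, (Q i).Rel)
  finite_rel :=
    have := fun i => (Q i).finite_rel
    inferInstance
  arity := glueArity Q k
  rules := (⋃ i, Rule.map (arity := glueArity Q k) (fun R => some ⟨i, R⟩) '' (Q i).rules) ∪
    Set.range fun ρ => ⟨⟨none, hd ρ⟩, bd ρ, hsafe ρ⟩
  finite_rules :=
    (Set.finite_iUnion fun i => (Q i).finite_rules.image _).union (Set.finite_range _)
  out := none
  outVars := outVars
  outVars_injective := houtVars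

theorem glue_satisfies {s : List A} {D : Database (glueArity Q k)} :
    (glue Q hd bd hsafe outVars houtVars).Satisfies s D ↔
      (∀ i, (Q i).Satisfies s fun R => D (some ⟨i, R⟩)) ∧
        ∀ ρ (a : V → Span), (∀ ψ ∈ bd ρ, ψ.Holds s D a) → (fun i => a (hd ρ i)) ∈ D none := by
  constructor
  · intro h
    refine ⟨fun i ρ hρ a ha => ?_, fun ρ a ha => h _ (.inr ⟨ρ, rfl⟩) a ha⟩
    refine h _ (.inl (Set.mem_iUnion.2 ⟨i, ρ, hρ, rfl⟩)) a fun ψ hψ => ?_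
    obtain ⟨χ, hχ, rfl⟩ := List.mem_map.1 hψ
    exact (Literal.map_holds _ χ).2 (ha χ hχ)
  · rintro ⟨h₁, h₂⟩ ρ (hρ | ⟨ρ, rfl⟩) a ha
    · obtain ⟨i, τ, hτ, rfl⟩ := Set.mem_iUnion.1 hρ
      exact h₁ i τ hτ a fun ψ hψ =>
        (Literal.map_holds (fun R => some ⟨i, R⟩) ψ).1 (ha _ (List.mem_map_of_mem hψ))
    · exact h₂ ρ a ha

/-- The rules of the new symbol do not affect the results of the given programs. -/
theorem glue_eval_some (s : List A) (i : I) (R : (Q i).Rel) :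
    (glue Q hd bd hsafe outVars houtVars).eval s (some ⟨i, R⟩) = (Q i).eval s R := by
  apply Set.Subset.antisymm
  · intro t ht
    refine ht (glueDatabase Q s Set.univ) ((glue_satisfies ..).2 ⟨fun i => ?_, ?_⟩)
    · exact ((Q i).eval_isLeast s).1
    · intro ρ a _
      trivial
  · intro t ht D hD
    exact ht _ (((glue_satisfies ..).1 hD).1 i)

/-- The output of the combined program is the least relation that is closed under the rules of
the new symbol, read over the results of the given programs. -/
theorem mem_glue_eval_none {s : List A} {t : Fin k → Span} :
    t ∈ (glue Q hd bd hsafe outVars houtVars).eval s none ↔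
      ∀ U : Set (Fin k → Span), (∀ ρ (a : V → Span),
        (∀ ψ ∈ bd ρ, ψ.Holds s (glueDatabase Q s U) a) → (fun i => a (hd ρ i)) ∈ U) → t ∈ U := by
  constructor
  · intro h U hU
    exact h (glueDatabase Q s U)
      ((glue_satisfies ..).2 ⟨fun i => ((Q i).eval_isLeast s).1, hU⟩)
  · intro h
    let E : Database (glueArity Q k) := (glue Q hd bd hsafe outVars houtVars).eval s
    have hE : (glue Q hd bd hsafe outVars houtVars).Satisfies s E :=
      ((glue Q hd bd hsafe outVars houtVars).eval_isLeast s).1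
    have heval : glueDatabase (k := k) Q s (E none) = E := by
      funext R
      rcases R with - | ⟨i, R⟩
      · rfl
      · exact (glue_eval_some ..).symm
    refine h (E none) fun ρ a ha => ?_
    rw [heval] at ha
    exact ((glue_satisfies ..).1 hE).2 ρ a ha

end Glue

/-! ### Some regex formulas -/

section BasicFormulas

variable {A : Type u} {V : Type v} [Finite A]

variable (A V) in
/-- The regular expression `Σ∗`. -/
noncomputable def Regex.all : Regex A V :=
  .star ((@Finset.univ A (Fintype.ofFinite A)).toList.foldr (fun σ γ => .alt (.letter σ) γ) .empty)

theorem parse_all {s : List A} {i j : ℕ} {c : List (V × Span)} :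
    Parse s (.all A V) i j c ↔ 1 ≤ i ∧ i ≤ j ∧ j ≤ s.length + 1 ∧ c = [] := by
  have hletters : ∀ (l : List A) {i j : ℕ} {c : List (V × Span)},
      Parse s (l.foldr (fun σ γ => .alt (.letter σ) γ) .empty) i j c ↔
        ∃ σ ∈ l, 1 ≤ i ∧ s[i - 1]? = some σ ∧ j = i + 1 ∧ c = [] := by
    intro l i j c
    induction l with
    | nil => simpa using parse_empty
    | cons σ l ih => simp only [List.foldr_cons, parse_alt, parse_letter, ih, List.mem_cons,
        exists_eq_or_imp]
  constructor
  · intro h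
    refine ⟨h.one_le.1, h.one_le.2, h.bound, ?_⟩
    generalize hγ : Regex.all A V = γ at h
    induction h with
    | starNil => rfl
    | starCons h₁ _ _ ih =>
      rw [Regex.all, Regex.star.injEq] at hγ
      rw [← hγ, hletters] at h₁
      obtain ⟨σ, -, -, -, -, rfl⟩ := h₁
      exact ih (by rw [Regex.all, hγ])
    | _ => cases hγ
  · rintro ⟨h₁, h₂, h₃, rfl⟩
    induction j, h₂ using Nat.le_induction with
    | base => exact .starNil h₁ h₃
    | succ j hj ih =>
      refine (ih (by omega)).star_append (c := []) (d := [] ++ []) (.starCons ((hletters _).2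
        ⟨s[j - 1], ?_, by omega, List.getElem?_eq_getElem (by omega), rfl, rfl⟩)
        (.starNil (by omega) h₃))
      exact Finset.mem_toList.2 (@Finset.mem_univ A (Fintype.ofFinite A) _)

/-- The empty span at the position `i`, where positions are counted from `0`. -/
def posSpan (i : ℕ) : Span := ⟨i + 1, i + 1, Nat.le_add_left 1 i, le_rfl⟩

theorem posSpan_injective : Function.Injective posSpan := fun i j h => by
  have := congrArg Span.left h
  simpa [posSpan] using this

variable [DecidableEq V]

omit [Finite A] in
/-- A regular expression that always makes the captures listed in `c`, of distinct variables,
is functional. -/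
theorem Regex.functional_of_captures {γ : Regex A V} {X : List V} (hX : X.Nodup)
    (hvars : γ.vars = X.toFinset)
    (h : ∀ s c, Parse s γ 1 (s.length + 1) c → c.map Prod.fst = X) : γ.Functional := by
  intro s c hc x hx
  rw [h s c hc]
  rw [hvars, List.mem_toFinset] at hx
  exact List.count_eq_one_of_mem hX hx

omit [Finite A] in
theorem RGX.mem_toSpanner_iff {γ : RGX A V} {s : List A} {a : V → Span} :
    Record.restrict (fun x => some (a x)) γ.regex.vars ∈ γ.toSpanner.rel s ↔
      ∃ c, Parse s γ.regex 1 (s.length + 1) c ∧ ∀ q ∈ c, a q.1 = q.2 := by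
  constructor
  · rintro ⟨c, h, hc⟩
    refine ⟨c, h, fun q hq => ?_⟩
    have h₁ := (hc q.1 q.2).2 hq
    simpa [Record.restrict, (h.mem_captures q hq).1] using h₁
  · rintro ⟨c, h, hc⟩
    refine ⟨c, h, fun x p => ⟨fun h₁ => ?_, fun h₁ => ?_⟩⟩
    · by_cases hx : x ∈ γ.regex.vars
      · have h₂ : x ∈ c.map Prod.fst :=
          List.count_pos_iff.1 (by rw [γ.functional s c h x hx]; exact Nat.one_pos)
        obtain ⟨q, hq, rfl⟩ := List.mem_map.1 h₂
        have h₃ : a q.1 = p := by simpa [Record.restrict, hx] using h₁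
        rwa [← h₃, hc q hq]
      · simp [Record.restrict, hx] at h₁
    · have h₂ := (h.mem_captures _ h₁).1
      have h₃ := hc _ h₁
      simp only at h₂ h₃
      simp [Record.restrict, h₂, h₃]

omit [DecidableEq V] in
theorem parse_position {s : List A} {x : V} {c : List (V × Span)} :
    Parse s (.concat (.all A V) (.concat (.capture x .epsilon) (.all A V))) 1 (s.length + 1) c ↔
      ∃ i ≤ s.length, c = [(x, posSpan i)] := by
  simp only [parse_concat, parse_capture, parse_all, parse_epsilon]
  constructor
  · rintro ⟨i, _, _, ⟨-, hi, hi', rfl⟩, ⟨k, _, _, ⟨p, _, hp, hp', ⟨-, -, hk, rfl⟩, rfl⟩,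
      ⟨-, -, -, rfl⟩, rfl⟩, rfl⟩
    refine ⟨i - 1, by omega, ?_⟩
    have : p = posSpan (i - 1) := by ext <;> simp only [posSpan] <;> omega
    rw [this]
    rfl
  · rintro ⟨i, hi, rfl⟩
    exact ⟨i + 1, [], _, ⟨le_rfl, by omega, by omega, rfl⟩, ⟨i + 1, _, [], ⟨posSpan i, [], rfl, rfl,
      ⟨by omega, by omega, rfl, rfl⟩, rfl⟩, ⟨by omega, by omega, le_rfl, rfl⟩, rfl⟩, rfl⟩

omit [DecidableEq V] in
theorem parse_letterBetween {s : List A} {σ : A} {x y : V} {c : List (V × Span)} :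
    Parse s (.concat (.all A V) (.concat (.capture x .epsilon) (.concat (.letter σ)
      (.concat (.capture y .epsilon) (.all A V))))) 1 (s.length + 1) c ↔
      ∃ i, s[i]? = some σ ∧ c = [(x, posSpan i), (y, posSpan (i + 1))] := by
  simp only [parse_concat, parse_capture, parse_all, parse_epsilon, parse_letter]
  constructor
  · rintro ⟨i, _, _, ⟨-, hi, hi', rfl⟩, ⟨i', _, _, ⟨p, _, hp, hp', ⟨-, -, hk, rfl⟩, rfl⟩,
      ⟨j, _, _, ⟨-, hσ, hj, rfl⟩, ⟨j', _, _, ⟨q, _, hq, hq', ⟨-, -, hk', rfl⟩, rfl⟩,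
      ⟨-, -, -, rfl⟩, rfl⟩, rfl⟩, rfl⟩, rfl⟩
    refine ⟨i - 1, by rwa [hk] at hσ, ?_⟩
    have h₁ : p = posSpan (i - 1) := by ext <;> simp only [posSpan] <;> omega
    have h₂ : q = posSpan (i - 1 + 1) := by ext <;> simp only [posSpan] <;> omega
    rw [h₁, h₂]
    rfl
  · rintro ⟨i, hσ, rfl⟩
    have hi := (List.getElem?_eq_some_iff.1 hσ).1
    exact ⟨i + 1, [], _, ⟨le_rfl, by omega, by omega, rfl⟩, ⟨i + 1, _, _, ⟨posSpan i, [], rfl, rfl,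
      ⟨by omega, by omega, rfl, rfl⟩, rfl⟩, ⟨i + 2, [], _, ⟨by omega, by simpa using hσ, rfl, rfl⟩,
      ⟨i + 2, _, [], ⟨posSpan (i + 1), [], rfl, rfl, ⟨by omega, by omega, rfl, rfl⟩, rfl⟩,
      ⟨by omega, by omega, le_rfl, rfl⟩, rfl⟩, rfl⟩, rfl⟩, rfl⟩

omit [DecidableEq V] in
theorem parse_ends {s : List A} {x y : V} {c : List (V × Span)} :
    Parse s (.concat (.capture x .epsilon) (.concat (.all A V) (.capture y .epsilon)))
      1 (s.length + 1) c ↔ c = [(x, posSpan 0), (y, posSpan s.length)] := by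
  simp only [parse_concat, parse_capture, parse_all, parse_epsilon]
  constructor
  · rintro ⟨i, _, _, ⟨p, _, hp, hp', ⟨-, -, hk, rfl⟩, rfl⟩, ⟨j, _, _, ⟨-, -, -, rfl⟩,
      ⟨q, _, hq, hq', ⟨-, -, hk', rfl⟩, rfl⟩, rfl⟩, rfl⟩
    have h₁ : p = posSpan 0 := by ext <;> simp only [posSpan] <;> omega
    have h₂ : q = posSpan s.length := by ext <;> simp only [posSpan] <;> omega
    rw [h₁, h₂]
    rfl
  · rintro rfl
    exact ⟨1, _, _, ⟨posSpan 0, [], rfl, rfl, ⟨le_rfl, by omega, rfl, rfl⟩, rfl⟩,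
      ⟨s.length + 1, [], _, ⟨le_rfl, by omega, le_rfl, rfl⟩,
      ⟨posSpan s.length, [], rfl, rfl, ⟨by omega, by omega, rfl, rfl⟩, rfl⟩, rfl⟩, rfl⟩

omit [DecidableEq V] in
theorem parse_spanEnds {s : List A} {x y z : V} {c : List (V × Span)} :
    Parse s (.concat (.all A V) (.concat (.capture x (.concat (.capture y .epsilon)
      (.concat (.all A V) (.capture z .epsilon)))) (.all A V))) 1 (s.length + 1) c ↔
      ∃ p : Span, p.IsSpanOf s ∧
        c = [(x, p), (y, posSpan (p.left - 1)), (z, posSpan (p.right - 1))] := by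
  simp only [parse_concat, parse_capture, parse_all, parse_epsilon]
  constructor
  · rintro ⟨i, _, _, ⟨-, hi, hi', rfl⟩, ⟨j, _, _, ⟨p, _, hp, hp', ⟨i', _, _, ⟨q, _, hq, hq',
      ⟨-, -, hk, rfl⟩, rfl⟩, ⟨j', _, _, ⟨-, hij, -, rfl⟩, ⟨r, _, hr, hr', ⟨-, -, hk', rfl⟩, rfl⟩,
      rfl⟩, rfl⟩, rfl⟩, ⟨-, hj, -, rfl⟩, rfl⟩, rfl⟩
    have h₁ : q = posSpan (p.left - 1) := by ext <;> simp only [posSpan] <;> omega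
    have h₂ : r = posSpan (p.right - 1) := by ext <;> simp only [posSpan] <;> omega
    refine ⟨p, by unfold Span.IsSpanOf; omega, ?_⟩
    rw [h₁, h₂]
    rfl
  · rintro ⟨p, hp, rfl⟩
    unfold Span.IsSpanOf at hp
    have h₁ := p.one_le_left
    have h₂ := p.left_le_right
    have h₃ : (posSpan (p.left - 1)).left = p.left := by simp only [posSpan]; omega
    have h₄ : (posSpan (p.right - 1)).left = p.right := by simp only [posSpan]; omega
    exact ⟨p.left, [], _, ⟨le_rfl, by omega, by omega, rfl⟩, ⟨p.right, _, [], ⟨p, _, rfl, rfl,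
      ⟨p.left, _, _, ⟨_, [], h₃, h₃, ⟨by omega, by omega, rfl, rfl⟩, rfl⟩,
      ⟨p.right, [], _, ⟨by omega, by omega, by omega, rfl⟩,
      ⟨_, [], h₄, h₄, ⟨by omega, by omega, rfl, rfl⟩, rfl⟩, rfl⟩, rfl⟩, rfl⟩,
      ⟨by omega, by omega, le_rfl, rfl⟩, rfl⟩, rfl⟩

theorem Regex.vars_all : (Regex.all A V).vars = ∅ := by
  have h : ∀ l : List A,
      (l.foldr (fun σ (γ : Regex A V) => .alt (.letter σ) γ) .empty).vars = ∅ := by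
    intro l
    induction l with
    | nil => rfl
    | cons σ l ih => simpa [Regex.vars] using ih
  exact h _

/-- The regex formula `Σ∗ x{ε} Σ∗`. -/
noncomputable def positionFormula (A : Type u) [Finite A] (x : V) : RGX A V where
  regex := .concat (.all A V) (.concat (.capture x .epsilon) (.all A V))
  functional := by
    refine Regex.functional_of_captures (X := [x]) (by simp) ?_ fun s c h => ?_
    · simp [Regex.vars, Regex.vars_all]
    · obtain ⟨i, -, rfl⟩ := parse_position.1 h
      rfl

/-- The regex formula `Σ∗ x{ε} σ y{ε} Σ∗`. -/
noncomputable def letterFormula (σ : A) {x y : V} (hxy : x ≠ y) : RGX A V where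
  regex := .concat (.all A V) (.concat (.capture x .epsilon) (.concat (.letter σ)
    (.concat (.capture y .epsilon) (.all A V))))
  functional := by
    refine Regex.functional_of_captures (X := [x, y]) (by simpa using hxy) ?_ fun s c h => ?_
    · simp [Regex.vars, Regex.vars_all]
    · obtain ⟨i, -, rfl⟩ := parse_letterBetween.1 h
      rfl

/-- The regex formula `x{ε} Σ∗ y{ε}`. -/
noncomputable def endsFormula (A : Type u) [Finite A] {x y : V} (hxy : x ≠ y) : RGX A V where
  regex := .concat (.capture x .epsilon) (.concat (.all A V) (.capture y .epsilon))
  functional := by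
    refine Regex.functional_of_captures (X := [x, y]) (by simpa using hxy) ?_ fun s c h => ?_
    · simp [Regex.vars, Regex.vars_all]
    · obtain rfl := parse_ends.1 h
      rfl

/-- The regex formula `Σ∗ x{y{ε} Σ∗ z{ε}} Σ∗`. -/
noncomputable def spanEndsFormula (A : Type u) [Finite A] {x y z : V} (h : [x, y, z].Nodup) :
    RGX A V where
  regex := .concat (.all A V) (.concat (.capture x (.concat (.capture y .epsilon)
    (.concat (.all A V) (.capture z .epsilon)))) (.all A V))
  functional := by
    refine Regex.functional_of_captures (X := [x, y, z]) h ?_ fun s c h => ?_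
    · simp [Regex.vars, Regex.vars_all]
    · obtain ⟨p, -, rfl⟩ := parse_spanEnds.1 h
      rfl

theorem mem_positionFormula {s : List A} {x : V} {a : V → Span} :
    Record.restrict (fun x => some (a x)) (positionFormula A x).regex.vars ∈
      (positionFormula A x).toSpanner.rel s ↔ ∃ i ≤ s.length, a x = posSpan i := by
  rw [RGX.mem_toSpanner_iff]
  constructor
  · rintro ⟨c, h, hc⟩
    obtain ⟨i, hi, rfl⟩ := parse_position.1 h
    exact ⟨i, hi, by simpa using hc⟩
  · rintro ⟨i, hi, h⟩
    exact ⟨_, parse_position.2 ⟨i, hi, rfl⟩, by simpa using h⟩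

theorem mem_letterFormula {s : List A} {σ : A} {x y : V} {hxy : x ≠ y} {a : V → Span} :
    Record.restrict (fun x => some (a x)) (letterFormula σ hxy).regex.vars ∈
      (letterFormula σ hxy).toSpanner.rel s ↔
        ∃ i, s[i]? = some σ ∧ a x = posSpan i ∧ a y = posSpan (i + 1) := by
  rw [RGX.mem_toSpanner_iff]
  constructor
  · rintro ⟨c, h, hc⟩
    obtain ⟨i, hi, rfl⟩ := parse_letterBetween.1 h
    exact ⟨i, hi, by simpa using hc⟩
  · rintro ⟨i, hi, h⟩
    exact ⟨_, parse_letterBetween.2 ⟨i, hi, rfl⟩, by simpa using h⟩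

theorem mem_endsFormula {s : List A} {x y : V} {hxy : x ≠ y} {a : V → Span} :
    Record.restrict (fun x => some (a x)) (endsFormula A hxy).regex.vars ∈
      (endsFormula A hxy).toSpanner.rel s ↔ a x = posSpan 0 ∧ a y = posSpan s.length := by
  rw [RGX.mem_toSpanner_iff]
  constructor
  · rintro ⟨c, h, hc⟩
    obtain rfl := parse_ends.1 h
    simpa using hc
  · rintro h
    exact ⟨_, parse_ends.2 rfl, by simpa using h⟩

theorem mem_spanEndsFormula {s : List A} {x y z : V} {h : [x, y, z].Nodup} {a : V → Span} :
    Record.restrict (fun x => some (a x)) (spanEndsFormula A h).regex.vars ∈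
      (spanEndsFormula A h).toSpanner.rel s ↔
        (a x).IsSpanOf s ∧ a y = posSpan ((a x).left - 1) ∧ a z = posSpan ((a x).right - 1) := by
  rw [RGX.mem_toSpanner_iff]
  constructor
  · rintro ⟨c, h, hc⟩
    obtain ⟨p, hp, rfl⟩ := parse_spanEnds.1 h
    obtain ⟨rfl, h₂, h₃⟩ : a x = p ∧ a y = _ ∧ a z = _ := by simpa using hc
    exact ⟨hp, h₂, h₃⟩
  · rintro ⟨hp, h₁, h₂⟩
    exact ⟨_, parse_spanEnds.2 ⟨a x, hp, rfl⟩, by simpa using ⟨h₁, h₂⟩⟩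

end BasicFormulas

/-! ### Relations on positions that are definable by programs -/

section Definable

theorem exists_injective_fin {V : Type v} [Infinite V] (k : ℕ) :
    ∃ f : Fin k → V, Function.Injective f :=
  ⟨fun i => Infinite.natEmbedding V i,
    (Infinite.natEmbedding V).injective.comp Fin.val_injective⟩

theorem exists_assignment {V : Type v} {k : ℕ} {x : Fin k → V} (hx : Function.Injective x)
    (t : Fin k → Span) :
    ∃ a : V → Span, ∀ i, a (x i) = t i :=
  ⟨Function.extend x t fun _ => posSpan 0, hx.extend_apply _ _⟩

variable {A : Type u} {V : Type v} [DecidableEq V]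

variable (V) in
/-- The relation `G` between positions is computed by a program, which represents a position by
the empty span at it. -/
def RGXlogDefinable {W : Type} (G : List A → (W → ℕ) → Prop) : Prop :=
  ∃ (Q : RGXlog A V) (e : Fin (Q.arity Q.out) → W), ∀ s v, (∀ x, v x ≤ s.length) →
    (G s v ↔ (fun i => posSpan (v (e i))) ∈ Q.eval s Q.out)

theorem RGXlogDefinable.congr {W : Type} {G G' : List A → (W → ℕ) → Prop}
    (hG : RGXlogDefinable V G) (h : ∀ s v, (∀ x, v x ≤ s.length) → (G s v ↔ G' s v)) :
    RGXlogDefinable V G' := by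
  obtain ⟨Q, e, hQ⟩ := hG
  exact ⟨Q, e, fun s v hv => (h s v hv).symm.trans (hQ s v hv)⟩

theorem RGXlogDefinable.comp {W W' : Type} {G : List A → (W → ℕ) → Prop}
    (hG : RGXlogDefinable V G) (f : W → W') :
    RGXlogDefinable V (fun s (v : W' → ℕ) => G s (fun x => v (f x))) := by
  obtain ⟨Q, e, hQ⟩ := hG
  exact ⟨Q, fun i => f (e i), fun s v hv => hQ s _ fun x => hv (f x)⟩

variable [Infinite V]

/-- A relation is definable if it consists of the positions `v ∘ f` that occur as the values of the
variables `e` in the records of a regex formula. -/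
theorem RGXlogDefinable.of_rgx (γ : RGX A V) {k : ℕ} (e : Fin k → V)
    (he : ∀ i, e i ∈ γ.regex.vars) {W : Type} (f : Fin k → W) {G : List A → (W → ℕ) → Prop}
    (hG : ∀ s v, (∀ x, v x ≤ s.length) → (G s v ↔ ∃ a : V → Span,
      Record.restrict (fun x => some (a x)) γ.regex.vars ∈ γ.toSpanner.rel s ∧
        ∀ i, a (e i) = posSpan (v (f i)))) : RGXlogDefinable V G := by
  obtain ⟨outVars, houtVars⟩ := exists_injective_fin (V := V) k
  refine ⟨glue (I := Empty) (J := Unit) (k := k) nofun (fun _ => e) (fun _ => [.rgx γ])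
    (fun _ i => ⟨_, List.mem_singleton_self _, he i⟩) outVars houtVars, f, fun s v hv => ?_⟩
  refine (hG s v hv).trans (Iff.trans ?_ (mem_glue_eval_none ..).symm)
  constructor
  · rintro ⟨a, ha, h⟩ U hU
    refine Set.mem_of_eq_of_mem (funext fun i => (h i).symm) (hU () a fun ψ hψ => ?_)
    rw [List.mem_singleton.1 hψ]
    exact ha
  · intro h
    obtain ⟨a, ha, h'⟩ := h {t | ∃ a : V → Span,
      Record.restrict (fun x => some (a x)) γ.regex.vars ∈ γ.toSpanner.rel s ∧
        ∀ i, a (e i) = t i} fun _ a ha =>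
        ⟨a, ha _ (List.mem_singleton_self _), fun _ => rfl⟩
    exact ⟨a, ha, h'⟩

variable [Finite A]

/-- Closure under least fixed points. The rules are indexed by `J`; the body of the rule `ρ`
consists of the definable relations `E ρ i` between the variables in `X` and of the atoms of the
defined relation `U` with the arguments in the list `bd ρ`. A regex formula `Σ∗ x{ε} Σ∗` for each
variable is added to the bodies, so that all rules are safe and only positions are considered.
The hypothesis `sound` says that `U` is closed under the rules, and `complete` that it is contained
in every relation closed under the rules. -/
theorem RGXlogDefinable.lfp {κ X J I : Type} [Finite κ] [Finite X] [Finite J] [Finite I]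
    {E : J → I → List A → (X → ℕ) → Prop} (hE : ∀ ρ i, RGXlogDefinable V (E ρ i))
    (hd : J → κ → X) (bd : J → List (κ → X)) {U : List A → (κ → ℕ) → Prop}
    (sound : ∀ s ρ (v : X → ℕ), (∀ x, v x ≤ s.length) → (∀ i, E ρ i s v) →
      (∀ b ∈ bd ρ, U s (fun x => v (b x))) → U s (fun x => v (hd ρ x)))
    (complete : ∀ s (T : (κ → ℕ) → Prop),
      (∀ ρ (v : X → ℕ), (∀ x, v x ≤ s.length) → (∀ i, E ρ i s v) →
        (∀ b ∈ bd ρ, T (fun x => v (b x))) → T (fun x => v (hd ρ x))) →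
      ∀ w, (∀ x, w x ≤ s.length) → U s w → T w) :
    RGXlogDefinable V U := by
  choose Q e hQ using hE
  obtain ⟨k, ⟨ε⟩⟩ := Finite.exists_equiv_fin κ
  obtain ⟨n, ⟨δ⟩⟩ := Finite.exists_equiv_fin X
  obtain ⟨m, ⟨ι⟩⟩ := Finite.exists_equiv_fin I
  obtain ⟨outVars, houtVars⟩ := exists_injective_fin (V := V) k
  obtain ⟨g₀, hg₀⟩ := exists_injective_fin (V := V) n
  let g : X → V := fun x => g₀ (δ x)
  have hg : Function.Injective g := hg₀.comp δ.injective
  let P : J × I → RGXlog A V := fun ρi => Q ρi.1 ρi.2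
  let body : J → List (Literal A (glueArity P k) V) := fun ρ =>
    List.ofFn (fun x => .rgx (positionFormula A (g₀ x))) ++
      (List.ofFn (fun i => .idb ⟨some ⟨(ρ, ι.symm i), (Q ρ (ι.symm i)).out⟩,
        fun j => g (e ρ (ι.symm i) j)⟩) ++
        (bd ρ).map fun b => .idb ⟨none, fun j : Fin k => g (b (ε.symm j))⟩)
  have hbody : ∀ ρ s (T : Set (Fin k → Span)) (a : V → Span),
      (∀ ψ ∈ body ρ, ψ.Holds s (glueDatabase P s T) a) ↔
        (∀ x, ∃ i ≤ s.length, a (g x) = posSpan i) ∧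
        (∀ i, (fun j => a (g (e ρ i j))) ∈ (Q ρ i).eval s (Q ρ i).out) ∧
        ∀ b ∈ bd ρ, (fun j => a (g (b (ε.symm j)))) ∈ T := by
    intro ρ s T a
    simp only [body, List.mem_append, or_imp, forall_and, List.mem_ofFn, forall_exists_index,
      forall_apply_eq_imp_iff, List.mem_map, and_imp, forall_apply_eq_imp_iff₂]
    refine and_congr ?_ (and_congr ?_ ?_)
    · refine (forall_congr' fun x => mem_positionFormula).trans ?_
      exact ⟨fun h x => h (δ x), fun h x => by simpa [g] using h (δ.symm x)⟩
    · exact (ι.symm.surjective.forall (p := fun i =>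
        (fun j => a (g (e ρ i j))) ∈ (Q ρ i).eval s (Q ρ i).out)).symm
    · exact Iff.rfl
  refine ⟨glue P (fun ρ i => g (hd ρ (ε.symm i))) body (fun ρ i => ?_) outVars houtVars, ε.symm,
    fun s w hw => ?_⟩
  · refine ⟨.rgx (positionFormula A (g (hd ρ (ε.symm i)))), ?_, ?_⟩
    · exact List.mem_append_left _ (List.mem_ofFn.2 ⟨_, rfl⟩)
    · simp [Literal.Occurs, positionFormula, Regex.vars]
  refine Iff.trans ?_ (mem_glue_eval_none ..).symm
  simp only [hbody]
  constructor
  · intro h T hT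
    refine complete s (fun w => (fun j => posSpan (w (ε.symm j))) ∈ T) ?_ w hw h
    intro ρ v hv h₁ h₂
    have ha : ∀ x, Function.extend g (fun x => posSpan (v x)) (fun _ => posSpan 0) (g x) =
      posSpan (v x) := hg.extend_apply _ _
    have h₃ := hT ρ (Function.extend g (fun x => posSpan (v x)) (fun _ => posSpan 0))
      ⟨fun x => ⟨v x, hv x, ha x⟩, fun i => by simpa only [ha] using (hQ ρ i s v hv).1 (h₁ i),
        fun b hb => by simpa only [ha] using h₂ b hb⟩
    simpa only [ha] using h₃
  · intro h
    have h₁ := h {t | ∀ w, (∀ x, w x ≤ s.length) → t = (fun j => posSpan (w (ε.symm j))) → U s w} ?_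
    · exact h₁ w hw rfl
    · rintro ρ a ⟨ha, h₁, h₂⟩ w - hw
      choose v hv hav using ha
      simp only [hav] at h₁ h₂ hw
      have h₃ : w = fun x => v (hd ρ x) := by
        funext x
        simpa using (posSpan_injective (congrFun hw (ε x))).symm
      rw [h₃]
      exact sound s ρ v hv (fun i => (hQ ρ i s v hv).2 (h₁ i))
        fun b hb => h₂ b hb _ (fun x => hv _) rfl

/-- Definitions by recursion with one rule `U(hd₀) ← E₀` and one rule `U(hd₁) ← E₁, U(b), …`. -/
theorem RGXlogDefinable.recursion {κ X : Type} [Finite κ] [Finite X]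
    {E₀ E₁ : List A → (X → ℕ) → Prop} (h₀ : RGXlogDefinable V E₀) (h₁ : RGXlogDefinable V E₁)
    (hd₀ hd₁ : κ → X) (bd : List (κ → X)) {U : List A → (κ → ℕ) → Prop}
    (base : ∀ s (v : X → ℕ), (∀ x, v x ≤ s.length) → E₀ s v → U s (fun x => v (hd₀ x)))
    (step : ∀ s (v : X → ℕ), (∀ x, v x ≤ s.length) → E₁ s v →
      (∀ b ∈ bd, U s (fun x => v (b x))) → U s (fun x => v (hd₁ x)))
    (complete : ∀ s (T : (κ → ℕ) → Prop),
      (∀ v : X → ℕ, (∀ x, v x ≤ s.length) → E₀ s v → T (fun x => v (hd₀ x))) →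
      (∀ v : X → ℕ, (∀ x, v x ≤ s.length) → E₁ s v → (∀ b ∈ bd, T (fun x => v (b x))) →
        T (fun x => v (hd₁ x))) →
      ∀ w, (∀ x, w x ≤ s.length) → U s w → T w) :
    RGXlogDefinable V U := by
  refine RGXlogDefinable.lfp (J := Bool) (I := Unit) (E := fun b _ => cond b E₁ E₀)
    (by rintro (- | -) -; exacts [h₀, h₁]) (fun b => cond b hd₁ hd₀) (fun b => cond b bd []) ?_ ?_
  · rintro s (- | -) v hv hE hb
    exacts [base s v hv (hE ()), step s v hv (hE ()) hb]
  · intro s T hT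
    exact complete s T (fun v hv h => hT Bool.false v hv (fun _ => h) (by simp))
      fun v hv h hb => hT Bool.true v hv (fun _ => h) hb

section Closure

variable {W : Type} [Finite W] {G G' : List A → (W → ℕ) → Prop}

theorem RGXlogDefinable.true : RGXlogDefinable V (fun (_ : List A) (_ : W → ℕ) => True) :=
  RGXlogDefinable.lfp (J := Unit) (I := Empty) (X := W) (E := nofun) nofun (fun _ => id)
    (fun _ => []) (fun _ _ _ _ _ _ => trivial)
    fun _ _ hT w hw _ => hT () w hw nofun (by simp)

theorem RGXlogDefinable.and (h : RGXlogDefinable V G) (h' : RGXlogDefinable V G') :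
    RGXlogDefinable V (fun s v => G s v ∧ G' s v) := by
  refine RGXlogDefinable.lfp (J := Unit) (I := Bool) (E := fun _ b => cond b G' G)
    (by rintro - (- | -); exacts [h, h']) (fun _ => id) (fun _ => []) ?_ ?_
  · exact fun s _ v _ hE _ => ⟨hE Bool.false, hE Bool.true⟩
  · refine fun s T hT w hw hG => hT () w hw ?_ (by simp)
    rintro (- | -)
    exacts [hG.1, hG.2]

theorem RGXlogDefinable.or (h : RGXlogDefinable V G) (h' : RGXlogDefinable V G') :
    RGXlogDefinable V (fun s v => G s v ∨ G' s v) := by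
  refine RGXlogDefinable.recursion h h' id id [] ?_ ?_ ?_
  · exact fun s v _ h => .inl h
  · exact fun s v _ h _ => .inr h
  · intro s T h₀ h₁ w hw hG
    exact hG.elim (fun h => h₀ w hw h) fun h => h₁ w hw h (by simp)

theorem RGXlogDefinable.ex {G : List A → (W → ℕ) → ℕ → Prop}
    (h : RGXlogDefinable V (fun s (v : Option W → ℕ) => G s (fun x => v (some x)) (v none))) :
    RGXlogDefinable V (fun s v => ∃ k ≤ s.length, G s v k) := by
  refine RGXlogDefinable.lfp (J := Unit) (I := Unit) (fun _ _ => h) (fun _ => some) (fun _ => [])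
    ?_ ?_
  · exact fun s _ v hv hE _ => ⟨v none, hv none, hE ()⟩
  · rintro s T hT w hw ⟨k, hk, hG⟩
    refine hT () (fun o => o.elim k w) ?_ (fun _ => hG) (by simp)
    rintro (- | x)
    exacts [hk, hw x]

theorem RGXlogDefinable.false : RGXlogDefinable V (fun (_ : List A) (_ : W → ℕ) => False) :=
  RGXlogDefinable.lfp (J := Empty) (I := Empty) (X := W) (E := nofun) nofun nofun
    nofun nofun fun _ _ _ _ _ h => h.elim

theorem RGXlogDefinable.finset_or {ι : Type*} (F : Finset ι) {G : ι → List A → (W → ℕ) → Prop}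
    (h : ∀ i ∈ F, RGXlogDefinable V (G i)) :
    RGXlogDefinable V (fun s v => ∃ i ∈ F, G i s v) := by
  classical
  induction F using Finset.induction_on with
  | empty => exact RGXlogDefinable.false.congr fun _ _ _ => by simp
  | insert i F hi ih =>
    exact ((h i (by simp)).or (ih fun j hj => h j (by simp [hj]))).congr fun _ _ _ => by simp

omit [Finite W] in
theorem RGXlogDefinable.letterBetween (σ : A) (x y : W) :
    RGXlogDefinable V (fun s v => s[v x]? = some σ ∧ v y = v x + 1) := by
  obtain ⟨e, he⟩ := exists_injective_fin (V := V) 2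
  have hne : e 0 ≠ e 1 := he.ne (by decide)
  refine RGXlogDefinable.of_rgx (letterFormula σ hne) e ?_ ![x, y] fun s v _ => ?_
  · rw [Fin.forall_fin_two]
    simp [letterFormula, Regex.vars]
  · simp only [mem_letterFormula, Fin.forall_fin_two, Matrix.cons_val_zero, Matrix.cons_val_one]
    constructor
    · rintro ⟨h₁, h₂⟩
      obtain ⟨a, ha⟩ := exists_assignment he ![posSpan (v x), posSpan (v y)]
      exact ⟨a, ⟨v x, h₁, ha 0, h₂ ▸ ha 1⟩, ha 0, ha 1⟩
    · rintro ⟨a, ⟨i, hi, h₀, h₁⟩, h₂, h₃⟩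
      obtain rfl := posSpan_injective (h₀.symm.trans h₂)
      exact ⟨hi, posSpan_injective (h₃.symm.trans h₁)⟩

omit [Finite W] in
theorem RGXlogDefinable.ends (x y : W) :
    RGXlogDefinable V (fun (s : List A) v => v x = 0 ∧ v y = s.length) := by
  obtain ⟨e, he⟩ := exists_injective_fin (V := V) 2
  have hne : e 0 ≠ e 1 := he.ne (by decide)
  refine RGXlogDefinable.of_rgx (endsFormula A hne) e ?_ ![x, y] fun s v _ => ?_
  · rw [Fin.forall_fin_two]
    simp [endsFormula, Regex.vars]
  · simp only [mem_endsFormula, Fin.forall_fin_two, Matrix.cons_val_zero, Matrix.cons_val_one]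
    constructor
    · rintro ⟨h₁, h₂⟩
      obtain ⟨a, ha⟩ := exists_assignment he ![posSpan 0, posSpan s.length]
      exact ⟨a, ⟨ha 0, ha 1⟩, by rw [h₁]; exact ha 0, by rw [h₂]; exact ha 1⟩
    · rintro ⟨a, ⟨h₀, h₁⟩, h₂, h₃⟩
      exact ⟨posSpan_injective (h₂.symm.trans h₀), posSpan_injective (h₃.symm.trans h₁)⟩

theorem RGXlogDefinable.first (x : W) : RGXlogDefinable V (fun (_ : List A) v => v x = 0) := by
  have h : RGXlogDefinable V (fun (s : List A) (v : W → ℕ) =>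
      ∃ k ≤ s.length, v x = 0 ∧ k = s.length) := .ex (.ends (some x) none)
  exact h.congr fun s v _ => by simp

theorem RGXlogDefinable.last (x : W) :
    RGXlogDefinable V (fun (s : List A) v => v x = s.length) := by
  have h : RGXlogDefinable V (fun (s : List A) (v : W → ℕ) =>
      ∃ k ≤ s.length, k = 0 ∧ v x = s.length) := .ex (.ends none (some x))
  exact h.congr fun s v _ => by simp

theorem RGXlogDefinable.letter (σ : A) (x : W) :
    RGXlogDefinable V (fun s v => s[v x]? = some σ) := by
  have h : RGXlogDefinable V (fun (s : List A) (v : W → ℕ) =>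
      ∃ k ≤ s.length, s[v x]? = some σ ∧ k = v x + 1) := .ex (.letterBetween σ (some x) none)
  refine h.congr fun s v _ => ⟨fun ⟨_, _, h, _⟩ => h, fun h => ?_⟩
  have := (List.getElem?_eq_some_iff.1 h).1
  exact ⟨_, this, h, rfl⟩

theorem RGXlogDefinable.succ (x y : W) :
    RGXlogDefinable V (fun (_ : List A) v => v y = v x + 1) := by
  have := Fintype.ofFinite A
  refine (RGXlogDefinable.finset_or Finset.univ fun σ _ =>
    RGXlogDefinable.letterBetween (V := V) σ x y).congr fun s v hv => ?_
  constructor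
  · rintro ⟨σ, -, -, h⟩
    exact h
  · intro h
    have := hv y
    exact ⟨s[v x], Finset.mem_univ _, List.getElem?_eq_getElem (by omega), h⟩

omit [Finite W] in
theorem RGXlogDefinable.le (x y : W) : RGXlogDefinable V (fun (_ : List A) v => v x ≤ v y) := by
  have h : RGXlogDefinable V (fun (_ : List A) (w : Fin 2 → ℕ) => w 0 ≤ w 1) := by
    refine RGXlogDefinable.recursion (X := Fin 3) .true (.succ 1 2) ![0, 0] ![0, 2] [![0, 1]]
      ?_ ?_ ?_
    · exact fun _ _ _ _ => le_rfl
    · intro s v _ h₁ h₂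
      have h₃ : v 0 ≤ v 1 := h₂ _ (List.mem_singleton_self _)
      change v 0 ≤ v 2
      omega
    · intro s T h₀ h₁ w hw h
      have key : ∀ j, w 0 ≤ j → j ≤ s.length → T ![w 0, j] := by
        intro j hj
        induction j, hj using Nat.le_induction with
        | base =>
          intro hj
          convert h₀ ![w 0, w 0, w 0] (by simpa [Fin.forall_fin_succ] using hj) trivial using 1
          ext x; fin_cases x <;> rfl
        | succ j hj ih =>
          intro hj'
          convert h₁ ![w 0, j, j + 1] (by simp [Fin.forall_fin_succ]; omega) rfl ?_ using 1
          · ext x; fin_cases x <;> rfl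
          · intro b hb
            rw [List.mem_singleton.1 hb]
            convert ih (by omega) using 1
            ext x; fin_cases x <;> rfl
      convert key (w 1) h (hw 1) using 1
      ext x; fin_cases x <;> rfl
  exact h.comp ![x, y]

theorem RGXlogDefinable.lt (x y : W) : RGXlogDefinable V (fun (_ : List A) v => v x < v y) := by
  have h : RGXlogDefinable V (fun (s : List A) (v : W → ℕ) =>
      ∃ k ≤ s.length, k = v x + 1 ∧ k ≤ v y) := .ex (.and (.succ (some x) none) (.le none (some y)))
  refine h.congr fun s v hv => ⟨by rintro ⟨k, -, rfl, h⟩; exact h, fun h => ?_⟩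
  have := hv y
  exact ⟨v x + 1, by omega, rfl, h⟩

omit [Finite W] in
theorem RGXlogDefinable.sameLength (a b c d : W) : RGXlogDefinable V
    (fun (_ : List A) v => v a ≤ v b ∧ v c ≤ v d ∧ v b + v c = v a + v d) := by
  have h : RGXlogDefinable V (fun (_ : List A) (w : Fin 4 → ℕ) =>
      w 0 ≤ w 1 ∧ w 2 ≤ w 3 ∧ w 1 + w 2 = w 0 + w 3) := by
    refine RGXlogDefinable.recursion (X := Fin 6) .true (.and (.succ 1 4) (.succ 3 5))
      ![0, 0, 2, 2] ![0, 4, 2, 5] [![0, 1, 2, 3]] ?_ ?_ ?_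
    · exact fun _ v _ _ => ⟨le_rfl, le_rfl, rfl⟩
    · rintro s v _ ⟨h₁, h₂⟩ h₃
      obtain ⟨h₄, h₅, h₆⟩ : v 0 ≤ v 1 ∧ v 2 ≤ v 3 ∧ v 1 + v 2 = v 0 + v 3 :=
        h₃ _ (List.mem_singleton_self _)
      change v 0 ≤ v 4 ∧ v 2 ≤ v 5 ∧ v 4 + v 2 = v 0 + v 5
      omega
    · rintro s T h₀ h₁ w hw ⟨h₂, h₃, h₄⟩
      have key : ∀ m, w 0 + m ≤ s.length → w 2 + m ≤ s.length →
          T ![w 0, w 0 + m, w 2, w 2 + m] := by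
        intro m
        induction m with
        | zero =>
          intro h h'
          convert h₀ ![w 0, 0, w 2, 0, 0, 0] (by simp [Fin.forall_fin_succ]; omega) trivial using 1
          ext x; fin_cases x <;> rfl
        | succ m ih =>
          intro h h'
          convert h₁ ![w 0, w 0 + m, w 2, w 2 + m, w 0 + m + 1, w 2 + m + 1]
            (by simp [Fin.forall_fin_succ]; omega) ⟨rfl, rfl⟩ ?_ using 1
          · ext x; fin_cases x <;> rfl
          · intro b hb
            rw [List.mem_singleton.1 hb]
            convert ih (by omega) (by omega) using 1
            ext x; fin_cases x <;> rfl
      have h₅ := hw 1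
      have h₆ := hw 3
      convert key (w 1 - w 0) (by omega) (by omega) using 1
      ext x
      fin_cases x
      · rfl
      · change w 1 = w 0 + (w 1 - w 0); omega
      · rfl
      · change w 3 = w 2 + (w 1 - w 0); omega
  exact h.comp ![a, b, c, d]

/-- Universal quantification over the positions is a recursion along the positions. -/
theorem RGXlogDefinable.all {G : List A → (W → ℕ) → ℕ → Prop}
    (h : RGXlogDefinable V (fun s (v : Option W → ℕ) => G s (fun x => v (some x)) (v none))) :
    RGXlogDefinable V (fun s v => ∀ k ≤ s.length, G s v k) := by
  have h' : RGXlogDefinable V (fun s (w : Option W → ℕ) =>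
      ∀ k ≤ w none, G s (fun x => w (some x)) k) := by
    refine RGXlogDefinable.recursion (X := Option (Option W))
      (.and (.first (some none)) (h.comp some))
      (.and (.succ (some none) none) (h.comp fun o => o.elim none fun x => some (some x)))
      some (fun o => o.elim none fun x => some (some x)) [some] ?_ ?_ ?_
    · rintro s v - ⟨h₁, h₂⟩ k (hk : k ≤ v (some none))
      obtain rfl : k = v (some none) := by omega
      exact h₂
    · rintro s v - ⟨h₁, h₂⟩ h₃ k (hk : k ≤ v none)
      rcases hk.eq_or_lt with rfl | hk
      · exact h₂
      · exact h₃ _ (List.mem_singleton_self _) k (show k ≤ v (some none) by omega)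
    · intro s T h₀ h₁ w hw h₂
      have key : ∀ m ≤ w none, T (fun o => o.elim m fun x => w (some x)) := by
        intro m
        induction m with
        | zero =>
          intro _
          refine h₀ (fun o => o.elim 0 fun o' => o'.elim 0 fun x => w (some x)) ?_
            ⟨rfl, h₂ 0 (Nat.zero_le _)⟩
          rintro (- | - | x)
          exacts [Nat.zero_le _, Nat.zero_le _, hw _]
        | succ m ih =>
          intro hm
          have hn := hw none
          convert h₁ (fun o => o.elim (m + 1) fun o' => o'.elim m fun x => w (some x)) ?_
            ⟨rfl, h₂ (m + 1) hm⟩ ?_ using 1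
          · ext (- | x) <;> rfl
          · rintro (- | - | x)
            exacts [show m + 1 ≤ s.length by omega, show m ≤ s.length by omega, hw _]
          · intro b hb
            rw [List.mem_singleton.1 hb]
            exact ih (by omega)
      convert key (w none) le_rfl using 1
      ext (- | x) <;> rfl
  have h'' : RGXlogDefinable V (fun s (v : W → ℕ) =>
      ∃ m ≤ s.length, m = s.length ∧ ∀ k ≤ m, G s v k) := .ex (.and (.last none) h')
  refine h''.congr fun s v _ => ⟨?_, fun h => ⟨_, le_rfl, rfl, h⟩⟩
  rintro ⟨_, -, rfl, h⟩
  exact h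

end Closure

section Star

variable {L : Language A}
  (hL : ∀ {W : Type} [Finite W] (x y : W),
    RGXlogDefinable V (fun s v => FactorMem L s (v x) (v y)))

include hL in
theorem RGXlogDefinable.factorMem_kstar {W : Type} [Finite W] (x y : W) :
    RGXlogDefinable V (fun s v => FactorMem L∗ s (v x) (v y)) := by
  have h : RGXlogDefinable V (fun s (w : Fin 2 → ℕ) => FactorMem L∗ s (w 0) (w 1)) := by
    refine RGXlogDefinable.recursion (X := Fin 3) .true (hL 1 2) ![0, 0] ![0, 2] [![0, 1]] ?_ ?_ ?_
    · exact fun s v hv _ => (DocSpanner.factorMem_kstar (hv 0)).2 (.inl rfl)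
    · intro s v hv h₁ h₂
      have h₃ : FactorMem L∗ s (v 0) (v 1) := h₂ _ (List.mem_singleton_self _)
      change FactorMem L∗ s (v 0) (v 2)
      rcases h₁.1.eq_or_lt with h | h
      · rwa [← h]
      · exact (DocSpanner.factorMem_kstar (hv 2)).2 (.inr ⟨_, h, h₃, h₁⟩)
    · intro s T h₀ h₁ w hw h
      have key : ∀ j ≤ s.length, FactorMem L∗ s (w 0) j → T ![w 0, j] := by
        intro j
        induction j using Nat.strong_induction_on with
        | _ j ih =>
          intro hj hR
          have h₂ := hw 0
          rcases (DocSpanner.factorMem_kstar hj).1 hR with rfl | ⟨k, hk, hR', hk'⟩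
          · convert h₀ ![w 0, w 0, w 0] (by simpa [Fin.forall_fin_succ] using hj) trivial using 1
            ext x; fin_cases x <;> rfl
          · convert h₁ ![w 0, k, j] (by simp [Fin.forall_fin_succ]; omega) hk' ?_ using 1
            · ext x; fin_cases x <;> rfl
            · intro b hb
              rw [List.mem_singleton.1 hb]
              convert ih k hk (by omega) hR' using 1
              ext x; fin_cases x <;> rfl
      convert key (w 1) (hw 1) h using 1
      ext x; fin_cases x <;> rfl
  exact h.comp ![x, y]

variable (hL' : ∀ {W : Type} [Finite W] (x y : W),
    RGXlogDefinable V (fun s v => ¬ FactorMem L s (v x) (v y)))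

/-- No position `k` with `i ≤ k < m` splits the factor between `i` and `j` into an element of `L∗`
and one of `L`. -/
def NoSplit (L : Language A) (s : List A) (i j m : ℕ) : Prop :=
  i ≤ m ∧ m ≤ j ∧ ∀ k, i ≤ k → k < m → FactorMem L∗ s i k → ¬ FactorMem L s k j

omit [DecidableEq V] [Infinite V] [Finite A] in
theorem noSplit_self_iff {s : List A} {i j : ℕ} (hij : i < j) (hj : j ≤ s.length) :
    NoSplit L s i j j ↔ ¬ FactorMem L∗ s i j := by
  rw [DocSpanner.factorMem_kstar hj]
  constructor
  · rintro ⟨-, -, h⟩ (rfl | ⟨k, hk, h₁, h₂⟩)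
    · exact lt_irrefl _ hij
    · exact h k h₁.1 hk h₁ h₂
  · intro h
    exact ⟨hij.le, le_rfl, fun k _ hk h₁ h₂ => h (.inr ⟨k, hk, h₁, h₂⟩)⟩

include hL' in
/-- The complement of the relation of `L∗` is definable since `NoSplit L s i j m` has a positive
recursion on `j` and `m`: that the factor between `i` and `k` is not in `L∗` is itself expressed by
`NoSplit L s i k k`. -/
theorem RGXlogDefinable.noSplit :
    RGXlogDefinable V (fun s (w : Fin 3 → ℕ) => NoSplit L s (w 0) (w 1) (w 2)) := by
  refine RGXlogDefinable.lfp (J := Fin 3) (I := Unit) (X := Fin 4)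
    (E := ![fun _ _ v => v 0 ≤ v 1,
      fun _ _ v => v 3 = v 2 + 1 ∧ v 3 ≤ v 1 ∧ v 0 < v 2,
      fun _ s v => v 3 = v 2 + 1 ∧ v 3 ≤ v 1 ∧ ¬ FactorMem L s (v 2) (v 1)]) ?_
    ![![0, 1, 0], ![0, 1, 3], ![0, 1, 3]] ![[], [![0, 1, 2], ![0, 2, 2]], [![0, 1, 2]]] ?_ ?_
  · intro ρ i
    fin_cases ρ
    · exact .le 0 1
    · exact .and (.succ 2 3) (.and (.le 3 1) (.lt 0 2))
    · exact .and (.succ 2 3) (.and (.le 3 1) (hL' 2 1))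
  · intro s ρ v hv hE hb
    fin_cases ρ
    · have h : v 0 ≤ v 1 := hE ()
      exact ⟨le_rfl, h, fun k h₁ h₂ => absurd h₁ (not_le.2 h₂)⟩
    · obtain ⟨h₁, h₂, h₃⟩ : v 3 = v 2 + 1 ∧ v 3 ≤ v 1 ∧ v 0 < v 2 := hE ()
      obtain ⟨h₄, h₅, h₆⟩ : NoSplit L s (v 0) (v 1) (v 2) := hb ![0, 1, 2] List.mem_cons_self
      have h₇ : NoSplit L s (v 0) (v 2) (v 2) :=
        hb ![0, 2, 2] (List.mem_cons_of_mem _ List.mem_cons_self)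
      rw [noSplit_self_iff h₃ (hv 2)] at h₇
      change NoSplit L s (v 0) (v 1) (v 3)
      refine ⟨by omega, h₂, fun k hk hk' hR => ?_⟩
      by_cases hkm : k = v 2
      · exact absurd (hkm ▸ hR) h₇
      · exact h₆ k hk (by omega) hR
    · obtain ⟨h₁, h₂, h₃⟩ : v 3 = v 2 + 1 ∧ v 3 ≤ v 1 ∧ ¬ FactorMem L s (v 2) (v 1) := hE ()
      obtain ⟨h₄, h₅, h₆⟩ : NoSplit L s (v 0) (v 1) (v 2) := hb ![0, 1, 2] List.mem_cons_self
      change NoSplit L s (v 0) (v 1) (v 3)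
      refine ⟨by omega, h₂, fun k hk hk' hR => ?_⟩
      by_cases hkm : k = v 2
      · rwa [hkm]
      · exact h₆ k hk (by omega) hR
  · intro s T hT w hw h
    have hT₀ : ∀ i j, i ≤ j → j ≤ s.length → T ![i, j, i] := fun i j hij hj => by
      convert hT 0 ![i, j, 0, 0] (by simp [Fin.forall_fin_succ]; omega) (fun _ => hij)
        (by simp) using 1
      ext x; fin_cases x <;> rfl
    have hT₁ : ∀ i j m, m + 1 ≤ j → i < m → j ≤ s.length → T ![i, j, m] → T ![i, m, m] →
        T ![i, j, m + 1] := fun i j m hm him hj h₁ h₂ => by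
      convert hT 1 ![i, j, m, m + 1] (by simp [Fin.forall_fin_succ]; omega)
        (fun _ => ⟨rfl, hm, him⟩) ?_ using 1
      · ext x; fin_cases x <;> rfl
      · intro b hb
        rcases List.mem_cons.1 hb with rfl | hb
        · convert h₁ using 1
          ext x; fin_cases x <;> rfl
        · rw [List.mem_singleton.1 hb]
          convert h₂ using 1
          ext x; fin_cases x <;> rfl
    have hT₂ : ∀ i j m, i ≤ m → m + 1 ≤ j → ¬ FactorMem L s m j → j ≤ s.length → T ![i, j, m] →
        T ![i, j, m + 1] := fun i j m him hm hR hj h₁ => by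
      convert hT 2 ![i, j, m, m + 1] (by simp [Fin.forall_fin_succ]; omega)
        (fun _ => ⟨rfl, hm, hR⟩) ?_ using 1
      · ext x; fin_cases x <;> rfl
      · intro b hb
        rw [List.mem_singleton.1 hb]
        convert h₁ using 1
        ext x; fin_cases x <;> rfl
    have key : ∀ j ≤ s.length, ∀ m, w 0 ≤ m → NoSplit L s (w 0) j m → T ![w 0, j, m] := by
      intro j
      induction j using Nat.strong_induction_on with
      | _ j ih =>
        intro hj m hm
        induction m, hm using Nat.le_induction with
        | base => exact fun h => hT₀ _ _ h.2.1 hj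
        | succ m hm ihm =>
          rintro ⟨-, h₁, h₂⟩
          have h₃ := ihm ⟨hm, by omega, fun k hk hk' => h₂ k hk (by omega)⟩
          by_cases hR : FactorMem L∗ s (w 0) m
          · exact hT₂ _ _ _ hm h₁ (h₂ m hm (by omega) hR) hj h₃
          · have hlt : w 0 < m := by
              refine lt_of_le_of_ne hm ?_
              rintro rfl
              exact hR ((DocSpanner.factorMem_kstar (hw 0)).2 (.inl rfl))
            exact hT₁ _ _ _ h₁ hlt hj h₃
              (ih m (by omega) (by omega) m hm ((noSplit_self_iff hlt (by omega)).2 hR))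
    convert key (w 1) (hw 1) (w 2) h.1 h using 1
    ext x; fin_cases x <;> rfl

include hL' in
theorem RGXlogDefinable.not_factorMem_kstar {W : Type} [Finite W] (x y : W) :
    RGXlogDefinable V (fun s v => ¬ FactorMem L∗ s (v x) (v y)) := by
  have h : RGXlogDefinable V (fun s (v : W → ℕ) => v y < v x ∨
      (v x < v y ∧ NoSplit L s (v x) (v y) (v y))) :=
    .or (.lt y x) (.and (.lt x y) ((RGXlogDefinable.noSplit hL').comp ![x, y, y]))
  refine h.congr fun s v hv => ?_
  constructor
  · rintro (h | ⟨h, h'⟩) hR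
    · exact absurd hR.1 (not_le.2 h)
    · exact (noSplit_self_iff h (hv y)).1 h' hR
  · intro hR
    rcases lt_trichotomy (v x) (v y) with h | h | h
    · exact .inr ⟨h, (noSplit_self_iff h (hv y)).2 hR⟩
    · exact absurd ((DocSpanner.factorMem_kstar (hv y)).2 (.inl h)) hR
    · exact .inl h

end Star

variable (A V) in
/-- The relations that are definable by programs together with their complements form a
definability class. -/
def rgxlogClass : DefinabilityClass A where
  Mem G := RGXlogDefinable V G ∧ RGXlogDefinable V (fun s v => ¬ G s v)
  congr h hG := ⟨hG.1.congr h, hG.2.congr fun s v hv => not_congr (h s v hv)⟩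
  comp f _ hG := ⟨hG.1.comp f, hG.2.comp f⟩
  not hG := ⟨hG.2, hG.1.congr fun _ _ _ => not_not.symm⟩
  and hG hG' := ⟨hG.1.and hG'.1, (hG.2.or hG'.2).congr fun _ _ _ => not_and_or.symm⟩
  ex hG := ⟨hG.1.ex, (RGXlogDefinable.all (G := fun s v k => ¬ _) hG.2).congr
    fun s v _ => by simp⟩
  le x y := ⟨.le x y, (RGXlogDefinable.lt y x).congr fun _ _ _ => not_le.symm⟩
  first {W} _ x := by
    have h : RGXlogDefinable V (fun (s : List A) (v : W → ℕ) => ∃ k ≤ s.length, v x = k + 1) :=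
      .ex (.succ none (some x))
    refine ⟨.first x, h.congr fun s v hv => ⟨?_, fun h' => ?_⟩⟩
    · rintro ⟨k, -, hk⟩
      omega
    · have := hv x
      exact ⟨v x - 1, by omega, by omega⟩
  last {W} _ x := by
    have h : RGXlogDefinable V (fun (s : List A) (v : W → ℕ) => ∃ k ≤ s.length, k = v x + 1) :=
      .ex (.succ (some x) none)
    refine ⟨.last x, h.congr fun s v hv => ⟨?_, fun h' => ?_⟩⟩
    · rintro ⟨k, hk, rfl⟩
      omega
    · have := hv x
      exact ⟨v x + 1, by omega, rfl⟩
  letter {W} _ σ x := by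
    classical
    have := Fintype.ofFinite A
    refine ⟨.letter σ x, (RGXlogDefinable.or (.last x) (.finset_or (Finset.univ.erase σ)
      fun τ _ => .letter τ x)).congr fun s v hv => ⟨?_, fun h => ?_⟩⟩
    · rintro (h | ⟨τ, hτ, h⟩) h'
      · rw [h, List.getElem?_eq_none le_rfl] at h'
        cases h'
      · exact Finset.ne_of_mem_erase hτ (Option.some.inj (h.symm.trans h'))
    · rcases (hv x).eq_or_lt with h' | h'
      · exact .inl h'
      · refine .inr ⟨s[v x], Finset.mem_erase.2 ⟨fun h'' => h ?_, Finset.mem_univ _⟩,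
          List.getElem?_eq_getElem h'⟩
        exact (List.getElem?_eq_getElem h').trans (congrArg some h'')
  sameLength {W} _ a b c d := by
    refine ⟨.sameLength a b c d, ?_⟩
    have h : RGXlogDefinable V (fun (s : List A) (v : W → ℕ) => (v b < v a ∨ v d < v c) ∨
        (∃ k ≤ s.length, k < v b ∧ v a ≤ k ∧ v c ≤ v d ∧ k + v c = v a + v d) ∨
        (∃ k ≤ s.length, k < v d ∧ v a ≤ v b ∧ v c ≤ k ∧ v b + v c = v a + k)) :=
      .or (.or (.lt b a) (.lt d c)) (.or
        (.ex (.and (.lt none (some b)) (.sameLength (some a) none (some c) (some d))))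
        (.ex (.and (.lt none (some d)) (.sameLength (some a) (some b) (some c) none))))
    refine h.congr fun s v hv => ⟨by omega, fun h' => ?_⟩
    have := hv b
    have := hv d
    by_cases h₁ : v b < v a
    · exact .inl (.inl h₁)
    by_cases h₂ : v d < v c
    · exact .inl (.inr h₂)
    rcases lt_or_gt_of_ne (show v b + v c ≠ v a + v d by omega) with h₃ | h₃
    · exact .inr (.inr ⟨v b + v c - v a, by omega⟩)
    · exact .inr (.inl ⟨v a + v d - v c, by omega⟩)
  star L hL {W} _ x y := ⟨.factorMem_kstar (fun x y => (hL x y).1) x y,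
    .not_factorMem_kstar (fun x y => (hL x y).2) x y⟩

end Definable

/-! ### Spanners with a definable relation between the ends of their spans -/

section Realize

variable {A : Type u} {V : Type v} [DecidableEq V] [Infinite V] [Finite A]

/-- A spanner is defined by a program as soon as the relation between the ends of the spans in its
records is definable: one more rule turns pairs of positions into spans. -/
theorem exists_toSpanner_eq {P : Spanner A V}
    (h : ∀ {W : Type} [Finite W] (l r : V → W), RGXlogDefinable V (fun s v =>
      recordOf P.vars (fun x => v (l x)) (fun x => v (r x)) ∈ P.rel s)) :
    ∃ Q : RGXlog A V, Q.toSpanner = P := by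
  obtain ⟨k, ⟨ε⟩⟩ := Finite.exists_equiv_fin P.vars
  let idx : V → Option (Fin k) := fun x => if hx : x ∈ P.vars then some (ε ⟨x, hx⟩) else none
  have hidx : ∀ {x} (hx : x ∈ P.vars), idx x = some (ε ⟨x, hx⟩) := fun hx => dif_pos hx
  obtain ⟨Q, e, hQ⟩ := h (fun x => (idx x, false)) (fun x => (idx x, true))
  obtain ⟨n, ⟨δ⟩⟩ := Finite.exists_equiv_fin (Option (Fin k) × Option Bool)
  obtain ⟨g₀, hg₀⟩ := exists_injective_fin (V := V) n
  -- The variable `g (o, none)` stands for a span, `g (o, some false)` and `g (o, some true)` for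
  -- its left and right ends.
  let g : Option (Fin k) × Option Bool → V := fun x => g₀ (δ x)
  have hg : Function.Injective g := hg₀.comp δ.injective
  have hnodup : ∀ o, [g (o, none), g (o, some false), g (o, some true)].Nodup := fun o => by
    simp [hg.eq_iff]
  let body : List (Literal A (glueArity (fun _ : Unit => Q) k) V) :=
    .idb ⟨some ⟨(), Q.out⟩, fun j => g ((e j).1, some (e j).2)⟩ ::
      (Finset.univ : Finset (Option (Fin k))).toList.map
        fun o => .rgx (spanEndsFormula A (hnodup o))
  let Valid : List A → (V → Span) → Prop := fun s a =>
    (fun j => a (g ((e j).1, some (e j).2))) ∈ Q.eval s Q.out ∧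
      ∀ o, (a (g (o, none))).IsSpanOf s ∧
        a (g (o, some false)) = posSpan ((a (g (o, none))).left - 1) ∧
        a (g (o, some true)) = posSpan ((a (g (o, none))).right - 1)
  have hbody : ∀ s (T : Set (Fin k → Span)) (a : V → Span),
      (∀ ψ ∈ body, ψ.Holds s (glueDatabase (fun _ : Unit => Q) s T) a) ↔
        Valid s a := by
    intro s T a
    simp only [body, List.forall_mem_cons, List.forall_mem_map, Finset.mem_toList,
      Finset.mem_univ, true_imp_iff]
    exact and_congr Iff.rfl (forall_congr' fun o => mem_spanEndsFormula)
  have hsafe : ∀ (_ : Unit) (i : Fin k), ∃ ψ ∈ body, ψ.Occurs (g (some i, none)) := by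
    intro _ i
    refine ⟨.rgx (spanEndsFormula A (hnodup (some i))), List.mem_cons_of_mem _
      (List.mem_map.2 ⟨some i, by simp, rfl⟩), ?_⟩
    simp [Literal.Occurs, spanEndsFormula, Regex.vars]
  have hout : Function.Injective fun i => (ε.symm i : V) :=
    Subtype.val_injective.comp ε.symm.injective
  have hrange : ∀ x, x ∈ Set.range (fun i => (ε.symm i : V)) ↔ x ∈ P.vars := fun x =>
    ⟨by rintro ⟨i, rfl⟩; exact (ε.symm i).2, fun hx => ⟨ε ⟨x, hx⟩, by simp⟩⟩
  have heval : ∀ s (t : Fin k → Span),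
      t ∈ (glue (fun _ : Unit => Q) (fun (_ : Unit) i => g (some i, none)) (fun _ => body) hsafe
        (fun i => (ε.symm i : V)) hout).eval s none ↔
      ∃ a : V → Span, Valid s a ∧ t = fun i => a (g (some i, none)) := by
    intro s t
    rw [mem_glue_eval_none]
    simp only [hbody]
    constructor
    · intro h
      exact h {t | ∃ a, Valid s a ∧ t = fun i => a (g (some i, none))} fun _ a ha => ⟨a, ha, rfl⟩
    · rintro ⟨a, ha, rfl⟩ T hT
      exact hT () a ha
  refine ⟨glue (fun _ : Unit => Q) (fun (_ : Unit) i => g (some i, none)) (fun _ => body) hsafe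
    (fun i => (ε.symm i : V)) hout, Spanner.ext ?_ ?_⟩
  · ext x
    refine Finset.mem_image.trans (Iff.trans ?_ (hrange x))
    exact ⟨fun ⟨i, _, hi⟩ => ⟨i, hi⟩, fun ⟨i, hi⟩ => ⟨i, Finset.mem_univ _, hi⟩⟩
  · funext s
    ext ρ
    constructor
    · rintro ⟨t, ht, h₁, h₂⟩
      obtain ⟨a, ⟨ha, hspan⟩, rfl⟩ := (heval s t).1 ht
      let w : Option (Fin k) × Bool → ℕ := fun x =>
        cond x.2 ((a (g (x.1, none))).right - 1) ((a (g (x.1, none))).left - 1)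
      have hw : ∀ x, w x ≤ s.length := by
        rintro ⟨o, b⟩
        have h₃ := (hspan o).1
        unfold Span.IsSpanOf at h₃
        have := (a (g (o, none))).left_le_right
        cases b <;> simp only [w, cond_true, cond_false] <;> omega
      have hav : ∀ x : Option (Fin k) × Bool, a (g (x.1, some x.2)) = posSpan (w x) := by
        rintro ⟨o, - | -⟩
        exacts [(hspan o).2.1, (hspan o).2.2]
      simp only [hav] at ha
      convert (hQ s w hw).2 ha using 1
      refine funext fun x => ?_
      by_cases hx : x ∈ P.vars
      · have h₃ : ρ x = some (a (g (some (ε ⟨x, hx⟩), none))) := by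
          have h₄ := h₁ (ε ⟨x, hx⟩)
          simp only [glue, Equiv.symm_apply_apply] at h₄
          exact h₄
        rw [h₃]
        symm
        rw [recordOf_eq_some]
        have := (a (g (some (ε ⟨x, hx⟩), none))).one_le_left
        have := (a (g (some (ε ⟨x, hx⟩), none))).left_le_right
        simp only [hidx hx, w, cond_true, cond_false]
        exact ⟨hx, by omega, by omega⟩
      · rw [h₂ x fun hx' => hx ((hrange x).1 hx')]
        simp [recordOf, hx]
    · intro hρ
      obtain ⟨l, r, hlr, rfl⟩ := (P.isRecord s ρ hρ).exists_eq_recordOf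
      have hle := fun {x} (hx : x ∈ P.vars) => ((P.isRecord s _ hρ).le_length hx).1
      let w : Option (Fin k) × Bool → ℕ := fun x =>
        x.1.elim 0 fun i => cond x.2 (r (ε.symm i)) (l (ε.symm i))
      have hw : ∀ x, w x ≤ s.length := by
        rintro ⟨- | i, - | -⟩
        exacts [Nat.zero_le _, Nat.zero_le _, (hlr _).1, (hlr _).2]
      have hw' : ∀ o, w (o, false) ≤ w (o, true) := by
        rintro (- | i)
        exacts [le_rfl, hle (ε.symm i).2]
      let b : Option (Fin k) × Option Bool → Span := fun x => x.2.elim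
        ⟨w (x.1, false) + 1, w (x.1, true) + 1, Nat.le_add_left 1 _, Nat.succ_le_succ (hw' _)⟩
        fun c => posSpan (w (x.1, c))
      have ha : ∀ x, Function.extend g b (fun _ => posSpan 0) (g x) = b x := hg.extend_apply _ _
      refine ⟨fun i => b (some i, none), (heval s _).2
        ⟨Function.extend g b (fun _ => posSpan 0), ⟨?_, fun o => ?_⟩,
          funext fun i => (ha (some i, none)).symm⟩, ?_, ?_⟩
      · simp only [ha]
        refine (hQ s w hw).1 ?_
        convert hρ using 1
        refine funext fun x => Option.ext fun p => ?_
        rw [recordOf_eq_some, recordOf_eq_some]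
        refine and_congr_right fun hx => ?_
        simp [hidx hx, w]
      · rw [ha, ha, ha]
        exact ⟨Nat.succ_le_succ (hw _), rfl, rfl⟩
      · exact fun i => recordOf_eq_some.2 ⟨(ε.symm i).2, rfl, rfl⟩
      · intro x hx
        have hx' : x ∉ P.vars := fun h => hx ((hrange x).2 h)
        simp [recordOf, hx']

theorem IsGeneralizedCore.exists_toSpanner_eq {P : Spanner A V} (hP : IsGeneralizedCore P) :
    ∃ Q : RGXlog A V, Q.toSpanner = P :=
  DocSpanner.exists_toSpanner_eq fun l r => (hP.memEnds (rgxlogClass A V) l r).1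

end Realize

/-! ### Powers of two -/

section PowTwo

variable (A : Type u) {V : Type v} [DecidableEq V] [Infinite V] [Finite A]

theorem RGXlogDefinable.double {W : Type} [Finite W] (x y : W) :
    RGXlogDefinable V (fun (_ : List A) v => v y = 2 * v x) := by
  have h : RGXlogDefinable V (fun (s : List A) (v : W → ℕ) =>
      ∃ z ≤ s.length, z = 0 ∧ z ≤ v x ∧ v x ≤ v y ∧ v x + v x = z + v y) :=
    .ex (.and (.first none) (.sameLength none (some x) (some x) (some y)))
  refine h.congr fun s v _ => ⟨?_, fun h' => ⟨0, by omega⟩⟩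
  rintro ⟨z, -, rfl, -, -, h'⟩
  omega

theorem RGXlogDefinable.length_eq_two_pow {W : Type} [Finite W] :
    RGXlogDefinable V (fun (s : List A) (_ : W → ℕ) => ∃ n, s.length = 2 ^ n) := by
  have hone : RGXlogDefinable V (fun (_ : List A) (v : Fin 2 → ℕ) => v 0 = 1) := by
    have h : RGXlogDefinable V (fun (s : List A) (v : Fin 2 → ℕ) =>
        ∃ z ≤ s.length, z = 0 ∧ v 0 = z + 1) := .ex (.and (.first none) (.succ none (some 0)))
    exact h.congr fun s v _ => by simp
  have hpow : RGXlogDefinable V (fun (_ : List A) (v : Unit → ℕ) => ∃ n, v () = 2 ^ n) := by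
    refine RGXlogDefinable.recursion hone (RGXlogDefinable.double A 0 1) (fun _ => 0) (fun _ => 1)
      [fun _ => 0] ?_ ?_ ?_
    · exact fun s v _ h => ⟨0, h⟩
    · intro s v _ h₁ h₂
      obtain ⟨n, hn⟩ := h₂ _ (List.mem_singleton_self _)
      replace hn : v 0 = 2 ^ n := hn
      exact ⟨n + 1, show v 1 = 2 ^ (n + 1) by rw [h₁, hn, pow_succ, mul_comm]⟩
    · rintro s T h₀ h₁ w hw ⟨n, hn⟩
      have key : ∀ n, 2 ^ n ≤ s.length → T fun _ => 2 ^ n := by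
        intro n
        induction n with
        | zero =>
          intro h
          exact h₀ (fun _ => 1) (fun _ => h) rfl
        | succ n ih =>
          intro h
          have hle : 2 ^ n ≤ s.length := (Nat.pow_le_pow_right two_pos n.le_succ).trans h
          refine h₁ ![2 ^ n, 2 ^ (n + 1)] (by simp [Fin.forall_fin_two, hle, h])
            (by simp [pow_succ, mul_comm]) fun b hb => ?_
          rw [List.mem_singleton.1 hb]
          exact ih hle
      convert key n (hn ▸ hw ()) using 1
      exact funext fun _ => hn
  have h : RGXlogDefinable V (fun (s : List A) (_ : W → ℕ) =>
      ∃ k ≤ s.length, k = s.length ∧ ∃ n, k = 2 ^ n) :=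
    .ex (.and (.last none) (hpow.comp fun _ => none))
  refine h.congr fun s v _ => ⟨?_, fun h => ⟨_, le_rfl, rfl, h⟩⟩
  rintro ⟨_, -, rfl, h⟩
  exact h

theorem exists_rgxlog_recognizes_powTwoLanguage :
    ∃ Q : RGXlog A V, Q.toSpanner.Recognizes (powTwoLanguage A) := by
  let P : Spanner A V :=
    { vars := ∅
      rel := fun s => {ρ | ρ = (fun _ => none) ∧ ∃ n, s.length = 2 ^ n}
      isRecord := by
        rintro s _ ⟨rfl, -⟩
        exact ⟨by simp, by simp⟩ }
  obtain ⟨Q, hQ⟩ := exists_toSpanner_eq (P := P) fun l r =>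
    (RGXlogDefinable.length_eq_two_pow A).congr fun s v _ => (and_iff_right rfl).symm
  have hP : P.IsBoolean := rfl
  refine ⟨Q, ?_⟩
  rw [hQ]
  exact ⟨hP, fun s => (and_iff_right rfl).symm.trans (Spanner.isTrueOn_iff hP).symm⟩

end PowTwo

end DocSpanner

theorem mainTheorem4 {A : Type u} [Finite A] [Nonempty A] {V : Type v} [DecidableEq V]
    [Infinite V] :
    (¬ ∃ P : DocSpanner.Spanner A V,
      DocSpanner.IsGeneralizedCore P ∧ P.Recognizes (DocSpanner.powTwoLanguage A)) ∧
    (∃ Q : DocSpanner.RGXlog A V, Q.toSpanner.Recognizes (DocSpanner.powTwoLanguage A)) ∧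
    {P : DocSpanner.Spanner A V | DocSpanner.IsGeneralizedCore P} ⊂
      {P : DocSpanner.Spanner A V | ∃ Q : DocSpanner.RGXlog A V, Q.toSpanner = P} := by
  obtain ⟨Q, hQ⟩ := DocSpanner.exists_rgxlog_recognizes_powTwoLanguage A (V := V)
  refine ⟨fun ⟨P, hP, h⟩ => DocSpanner.not_recognizes_powTwoLanguage hP h, ⟨Q, hQ⟩, ?_, ?_⟩
  · exact fun P hP => hP.exists_toSpanner_eq
  · exact fun h => DocSpanner.not_recognizes_powTwoLanguage (h ⟨Q, rfl⟩) hQ
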